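/- Let $n\ge 2$, $s\in(0,1)$, let $\Omega\subset\mathbb R^n$ be open and bounded, and let $0<\lambda\le\Lambda<\infty$. For $\psi\in C_c^\infty(\mathbb R^n)$ let $$\nabla^s\psi(x)=\frac{n-1+s}{\gamma_{1-s}}\int_{\mathbb R^n}\frac{(\psi(x)-\psi(y))(x-y)}{|x-y|^{n+s+1}}\,dy,\qquad \gamma_\alpha=2^\alpha\pi^{n/2}\frac{\Gamma(\alpha/2)}{\Gamma((n-\alpha)/2)},$$ let $H^s_0(\Omega)$ be the Hilbert space obtained as the closure of $C_c^\infty(\Omega)$ in the norm $(\|u\|_{L^2(\mathbb R^n)}^2+\|\nabla^su\|_{L^2(\mathbb R^n;\mathbb R^n)}^2)^{1/2}$ (with $\nabla^s$ extended by continuity), and let $H^{-s}(\Omega)$ be its dual. Let $\mathcal M^{\rm sym}(\lambda,\Lambda,\mathbb R^n)$ be the set of measurable $A\colon\mathbb R^n\to\mathbb R^{n\times n}$ such that, for a.e. $x\in\mathbb R^n$, $A(x)=A(x)^T$ and, for all $\xi\in\mathbb R^n$, $A(x)\xi\cdot\xi\ge\lambda|\xi|^2$ and $A(x)\xi\cdot\xi\ge\Lambda^{-1}|A(x)\xi|^2$.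 Let $A_h$ ($h\in\mathbb N$) and $A_\infty$ belong to $\mathcal M^{\rm sym}(\lambda,\Lambda,\mathbb R^n)$. For $h\in\mathbb N\cup\{\infty\}$ define $F_h\colon L^2(\mathbb R^n)\to[0,\infty]$ by $$F_h(u)=\begin{cases}\frac12\int_{\mathbb R^n}A_h(x)\nabla^su(x)\cdot\nabla^su(x)\,dx&\text{if }u\in H^s_0(\Omega),\\ \infty&\text{otherwise,}\end{cases}$$ and for $f\in H^{-s}(\Omega)$ let $u_h(f)\in H^s_0(\Omega)$ denote the unique weak solution of $-\mathrm{div}^s(A_h\nabla^su)=f$ in $\Omega$, $u=0$ in $\mathbb R^n\setminus\Omega$, that is, $\int_{\mathbb R^n}A_h\nabla^su_h(f)\cdot\nabla^sv\,dx=\langle f,v\rangle$ for all $v\in H^s_0(\Omega)$. Then the following two assertions are equivalent. (i) $(A_h)_h$ $G$-converges to $A_\infty$ in $H^s_0(\Omega)$: for every $f\in H^{-s}(\Omega)$, $u_h(f)\to u_\infty(f)$ weakly in $H^s_0(\Omega)$ as $h\to\infty$. (ii) $(F_h)_h$ $\Gamma$-converges to $F_\infty$ strongly in $L^2(\mathbb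 R^n)$: for every $u\in L^2(\mathbb R^n)$ one has $F_\infty(u)\le\liminf_{h\to\infty}F_h(u_h)$ for every sequence $u_h\to u$ in $L^2(\mathbb R^n)$, and there is a sequence $v_h\to u$ in $L^2(\mathbb R^n)$ with $\limsup_{h\to\infty}F_h(v_h)\le F_\infty(u)$. -/

import Mathlib

open MeasureTheory Filter Topology
open scoped ENNReal

noncomputable section

namespace NonlocalGConv

/-- The Euclidean space `ℝⁿ`. -/
abbrev Sp (n : ℕ) : Type := EuclideanSpace ℝ (Fin n)

/-- `L²(ℝⁿ)`, with Lebesgue measure. -/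
abbrev L2 (n : ℕ) : Type := Lp ℝ 2 (volume : Measure (Sp n))

/-- `L²(ℝⁿ; ℝⁿ)`, with Lebesgue measure. -/
abbrev L2Vec (n : ℕ) : Type := Lp (Sp n) 2 (volume : Measure (Sp n))

/-- `L²(ℝⁿ) × L²(ℝⁿ; ℝⁿ)` with the Hilbert norm `(‖u‖² + ‖g‖²)^(1/2)`. -/
abbrev L2Pair (n : ℕ) : Type := WithLp 2 (L2 n × L2Vec n)

/-- The normalisation constant `γ_α = 2^α π^(n/2) Γ(α/2) / Γ((n-α)/2)` of the Riesz potential. -/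
def rieszConst (n : ℕ) (α : ℝ) : ℝ :=
  (2 : ℝ) ^ α * Real.pi ^ ((n : ℝ) / 2) * Real.Gamma (α / 2) / Real.Gamma (((n : ℝ) - α) / 2)

/-- The `s`-fractional gradient of a test function `ψ` at the point `x`:
`(n - 1 + s) / γ_{1-s} ∫ (ψ(x) - ψ(y)) (x - y) / |x - y|^(n+s+1) dy`. -/
def fracGrad {n : ℕ} (s : ℝ) (ψ : Sp n → ℝ) (x : Sp n) : Sp n :=
  (((n : ℝ) - 1 + s) / rieszConst n (1 - s)) •
    ∫ y : Sp n, ((ψ x - ψ y) / ‖x - y‖ ^ ((n : ℝ) + s + 1)) • (x - y)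

/-- `ψ ∈ C_c^∞(O)`, as a function on `ℝⁿ` extended by zero outside `O`. -/
def IsTestFun {n : ℕ} (O : Set (Sp n)) (ψ : Sp n → ℝ) : Prop :=
  ContDiff ℝ ((⊤ : ℕ∞) : WithTop ℕ∞) ψ ∧ HasCompactSupport ψ ∧ tsupport ψ ⊆ O

/-- The pairs `(ψ, ∇ˢψ)` with `ψ ∈ C_c^∞(O)`, as elements of `L²(ℝⁿ) × L²(ℝⁿ; ℝⁿ)`. -/
def testPairs {n : ℕ} (s : ℝ) (O : Set (Sp n)) : Set (L2Pair n) :=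
  {U | ∃ ψ : Sp n → ℝ, IsTestFun O ψ ∧
    (U.fst : Sp n → ℝ) =ᵐ[volume] ψ ∧ (U.snd : Sp n → Sp n) =ᵐ[volume] fracGrad s ψ}

/-- The Hilbert space `H^s_0(O)`: the closure of `C_c^∞(O)` in the norm
`(‖u‖²_{L²} + ‖∇ˢu‖²_{L²})^(1/2)`. An element is stored as the pair `(u, ∇ˢu)`, so that the norm
and the inner product are those of the ambient space `L²(ℝⁿ) × L²(ℝⁿ; ℝⁿ)`. The set `testPairs s O`
is already a linear subspace; `Submodule.span` only records the submodule structure. -/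
def Hs0 {n : ℕ} (s : ℝ) (O : Set (Sp n)) : Submodule ℝ (L2Pair n) :=
  (Submodule.span ℝ (testPairs s O)).topologicalClosure

/-- The function `u ∈ L²(ℝⁿ)` underlying an element of `H^s_0(O)`. -/
def Hs0.toL2 {n : ℕ} {s : ℝ} {O : Set (Sp n)} (U : Hs0 s O) : L2 n := (U : L2Pair n).fst

/-- The fractional gradient `∇ˢu ∈ L²(ℝⁿ; ℝⁿ)` of an element of `H^s_0(O)`. -/
def Hs0.grad {n : ℕ} {s : ℝ} {O : Set (Sp n)} (U : Hs0 s O) : L2Vec n := (U : L2Pair n).snd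

/-- The class `𝓜(lam, Lam, ℝⁿ)` of (Lebesgue) measurable matrix fields with
`A(x)ξ·ξ ≥ lam |ξ|²` and `A(x)ξ·ξ ≥ Lam⁻¹ |A(x)ξ|²` for all `ξ` and a.e. `x`. -/
structure MClass {n : ℕ} (lam Lam : ℝ) (A : Sp n → Matrix (Fin n) (Fin n) ℝ) : Prop where
  aemeasurable : ∀ i j, AEMeasurable (fun x => A x i j) volume
  lower : ∀ᵐ x, ∀ ξ : Sp n, lam * ‖ξ‖ ^ 2 ≤ inner ℝ ((A x).toEuclideanLin ξ) ξ
  upper : ∀ᵐ x, ∀ ξ : Sp n,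
    Lam⁻¹ * ‖(A x).toEuclideanLin ξ‖ ^ 2 ≤ inner ℝ ((A x).toEuclideanLin ξ) ξ

/-- The class `𝓜^sym(lam, Lam, ℝⁿ)` of the a.e. symmetric elements of `𝓜(lam, Lam, ℝⁿ)`. -/
structure MSym {n : ℕ} (lam Lam : ℝ) (A : Sp n → Matrix (Fin n) (Fin n) ℝ) : Prop
    extends MClass lam Lam A where
  symm : ∀ᵐ x, A x = (A x).transpose

/-- The bilinear form `a(u, v) = ∫ A(x) ∇ˢu(x) · ∇ˢv(x) dx` on `H^s_0(O)`. -/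
def bilin {n : ℕ} {s : ℝ} {O : Set (Sp n)} (A : Sp n → Matrix (Fin n) (Fin n) ℝ)
    (U V : Hs0 s O) : ℝ :=
  ∫ x : Sp n, inner ℝ ((A x).toEuclideanLin (Hs0.grad U x)) (Hs0.grad V x)

/-- `u ∈ H^s_0(O)` is a weak solution of `-divˢ(A ∇ˢu) = f` in `O`, `u = 0` in `ℝⁿ \ O`,
for `f` in the dual space `H^{-s}(O)` of `H^s_0(O)`. -/
def IsWeakSol {n : ℕ} {s : ℝ} {O : Set (Sp n)} (A : Sp n → Matrix (Fin n) (Fin n) ℝ)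
    (f : StrongDual ℝ (Hs0 s O)) (U : Hs0 s O) : Prop :=
  ∀ V : Hs0 s O, bilin A U V = f V

/-- Weak convergence of a sequence in a real normed space. -/
def WeakTendsto {X : Type*} [NormedAddCommGroup X] [NormedSpace ℝ X] (u : ℕ → X) (u₀ : X) : Prop :=
  ∀ g : StrongDual ℝ X, Tendsto (fun h => g (u h)) atTop (𝓝 (g u₀))

/-- Nonlocal `G`-convergence in `H^s_0(O)`: for every `f ∈ H^{-s}(O)`, the weak solutions `u_h`
of the problems for `A_h` converge weakly in `H^s_0(O)` to the weak solution for `A_∞`. -/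
def GConverges {n : ℕ} (s : ℝ) (O : Set (Sp n)) (A : ℕ → Sp n → Matrix (Fin n) (Fin n) ℝ)
    (Ainf : Sp n → Matrix (Fin n) (Fin n) ℝ) : Prop :=
  ∀ (f : StrongDual ℝ (Hs0 s O)) (u : ℕ → Hs0 s O) (uinf : Hs0 s O),
    (∀ h, IsWeakSol (A h) f (u h)) → IsWeakSol Ainf f uinf → WeakTendsto u uinf

/-- The nonlocal energy `F : L²(ℝⁿ) → [0, ∞]` of `A`: `½ ∫ A ∇ˢu · ∇ˢu` if `u ∈ H^s_0(O)`, and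
`∞` otherwise. A function `u ∈ L²(ℝⁿ)` underlies at most one element `U` of `H^s_0(O)`, so the
infimum below is over one element, or over none (and then it is `∞`). -/
def energy {n : ℕ} (s : ℝ) (O : Set (Sp n)) (A : Sp n → Matrix (Fin n) (Fin n) ℝ)
    (u : L2 n) : ℝ≥0∞ :=
  ⨅ (U : Hs0 s O) (_ : Hs0.toL2 U = u), ENNReal.ofReal ((1 / 2) * bilin A U U)

/-- `Γ`-convergence of `E_h : X → [0, ∞]` to `E_∞` in the strong (norm) topology of `X`. -/
def GammaConverges {X : Type*} [NormedAddCommGroup X] (E : ℕ → X → ℝ≥0∞) (Einf : X → ℝ≥0∞) :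
    Prop :=
  (∀ (x : X) (xs : ℕ → X), Tendsto xs atTop (𝓝 x) →
      Einf x ≤ liminf (fun h => E h (xs h)) atTop) ∧
  (∀ x : X, ∃ ys : ℕ → X, Tendsto ys atTop (𝓝 x) ∧
      limsup (fun h => E h (ys h)) atTop ≤ Einf x)

end NonlocalGConv

end

/-! Both directions are one Hilbert space argument. Let `T : H → X` be injective and turn weak into
norm convergence, and let the symmetric forms `B h` be uniformly coercive on `H`. The solution for
`f` minimises `½ B h U U - f U`, and completing the square (`form_sub_sub`) measures the excess of
any competitor.

If solutions converge, take `f = Binf U` for the candidate limit `U`, so that the limit solution is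
`U` itself. The solutions `W h` for this `f` give a recovery sequence, since their energies are `½ f
(W h)`; and `½ B h V V ≥ f V - ½ f (W h)` reduces the liminf inequality to a limit of linear
expressions. Conversely, if `f = ⟪g, T ·⟫`, then `f` is a continuous perturbation on `X`, so
Γ-convergence forces weak limits of minimisers to minimise the limit functional. Such `f` are dense
in the dual because `T` is injective, and solutions are Lipschitz in `f` uniformly in `h`. The
result is `weakTendsto_iff_gammaConverges`.

The rest verifies coercivity, injectivity and compactness for `Hs0.toL2L`, on the Fourier side. The
fractional gradient is a multiplier whose symbol is at least a multiple of `|ξ|^s`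
(`exists_symbol_ge`): the imaginary part of its pairing with `ξ` is, by Euler's identity, a positive
multiple of the homogeneous function `cosInt`. This controls high frequencies. Low frequencies are
controlled by `|Ω| < ∞`: there `û(ξ)` is the inner product of `u` with a character cut off to `Ω`.
Together these give the Poincaré inequality and compactness. -/

namespace NonlocalGConv

/-! ### Weak convergence of solutions and Γ-convergence in Hilbert space -/

section Abstract

variable {H X : Type*} [NormedAddCommGroup H] [InnerProductSpace ℝ H]
  [NormedAddCommGroup X] [InnerProductSpace ℝ X]

/-- A bounded sequence in a separable Hilbert space has a weakly convergent subsequence. -/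
theorem exists_weakTendsto_subseq [CompleteSpace H] [TopologicalSpace.SeparableSpace H] (u : ℕ → H) (M : ℝ)
    (hu : ∀ k, ‖u k‖ ≤ M) :
    ∃ (u₀ : H) (φ : ℕ → ℕ), StrictMono φ ∧ WeakTendsto (u ∘ φ) u₀ := by
  -- The Riesz isometry carries the sequence to the dual, where sequential Banach–Alaoglu applies.
  have hc := WeakDual.isSeqCompact_closedBall (𝕜 := ℝ) (E := H) 0 M
  obtain ⟨a, -, φ, hφ, hlim⟩ := hc (x := fun k => StrongDual.toWeakDual
    (InnerProductSpace.toDual ℝ H (u k))) (by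
      intro k
      simpa using hu k)
  refine ⟨(InnerProductSpace.toDual ℝ H).symm (WeakDual.toStrongDual a), φ, hφ, fun g => ?_⟩
  have h1 := (WeakBilin.tendsto_iff_forall_eval_tendsto _
    (ContinuousLinearMap.coe_injective)).1 hlim ((InnerProductSpace.toDual ℝ H).symm g)
  have key : ∀ v : H, g v = inner ℝ v ((InnerProductSpace.toDual ℝ H).symm g) := by
    intro v
    rw [real_inner_comm, InnerProductSpace.toDual_symm_apply]
  simp only [key, InnerProductSpace.toDual_symm_apply]
  exact h1

theorem WeakTendsto.of_subseq {u : ℕ → H} {u₀ : H}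
    (h : ∀ φ : ℕ → ℕ, StrictMono φ → ∃ θ : ℕ → ℕ, WeakTendsto (u ∘ φ ∘ θ) u₀) :
    WeakTendsto u u₀ := by
  intro g
  refine tendsto_of_subseq_tendsto fun ns hns => ?_
  obtain ⟨φ, hφ, hφ'⟩ := strictMono_subseq_of_tendsto_atTop hns
  obtain ⟨θ, hθ⟩ := h _ hφ'
  exact ⟨φ ∘ θ, hθ g⟩

/-- The quadratic energy of a bilinear form, transported along `T`. -/
noncomputable def quadEnergy (T : H →L[ℝ] X) (B : H →L[ℝ] H →L[ℝ] ℝ) (x : X) : ℝ≥0∞ :=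
  ⨅ (U : H) (_ : T U = x), ENNReal.ofReal ((1 / 2) * B U U)

theorem quadEnergy_le (T : H →L[ℝ] X) (B : H →L[ℝ] H →L[ℝ] ℝ) (U : H) :
    quadEnergy T B (T U) ≤ ENNReal.ofReal ((1 / 2) * B U U) :=
  iInf₂_le (f := fun (V : H) (_ : T V = T U) => ENNReal.ofReal ((1 / 2) * B V V)) U rfl

theorem quadEnergy_apply {T : H →L[ℝ] X} (hT : Function.Injective T) (B : H →L[ℝ] H →L[ℝ] ℝ)
    (U : H) : quadEnergy T B (T U) = ENNReal.ofReal ((1 / 2) * B U U) := by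
  refine le_antisymm (quadEnergy_le T B U) (le_iInf₂ fun V hV => ?_)
  rw [hT hV]

theorem exists_of_quadEnergy_lt {T : H →L[ℝ] X} {B : H →L[ℝ] H →L[ℝ] ℝ} {x : X} {b : ℝ≥0∞}
    (h : quadEnergy T B x < b) : ∃ U, T U = x ∧ ENNReal.ofReal ((1 / 2) * B U U) < b := by
  simpa [quadEnergy, iInf_lt_iff] using h

theorem exists_solution [CompleteSpace H] {B : H →L[ℝ] H →L[ℝ] ℝ} {c : ℝ} (hc : 0 < c)
    (hB : ∀ u, c * ‖u‖ ^ 2 ≤ B u u) (f : StrongDual ℝ H) : ∃ W, ∀ V, B W V = f V := by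
  have hco : IsCoercive B := ⟨c, hc, fun u => by have := hB u; rwa [sq, ← mul_assoc] at this⟩
  refine ⟨hco.continuousLinearEquivOfBilin.symm ((InnerProductSpace.toDual ℝ H).symm f),
    fun V => ?_⟩
  rw [← hco.continuousLinearEquivOfBilin_apply, ContinuousLinearEquiv.apply_symm_apply,
    InnerProductSpace.toDual_symm_apply]

theorem norm_solution_le {B : H →L[ℝ] H →L[ℝ] ℝ} {c : ℝ} (hc : 0 < c)
    (hB : ∀ u, c * ‖u‖ ^ 2 ≤ B u u) {f : StrongDual ℝ H} {W : H} (hW : ∀ V, B W V = f V) :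
    ‖W‖ ≤ ‖f‖ / c := by
  rw [le_div_iff₀ hc]
  rcases eq_or_ne W 0 with rfl | h0
  · simp
  have h1 := hB W
  rw [hW] at h1
  have h2 := (le_abs_self _).trans (f.le_opNorm W)
  have h3 : 0 < ‖W‖ := norm_pos_iff.2 h0
  nlinarith

/-- Completing the square around a solution. -/
theorem form_sub_sub {B : H →L[ℝ] H →L[ℝ] ℝ} (hs : ∀ u v, B u v = B v u)
    {f : StrongDual ℝ H} {W : H} (hW : ∀ V, B W V = f V) (U : H) :
    (1 / 2) * B (U - W) (U - W) = (1 / 2) * B U U - f U + (1 / 2) * f W := by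
  simp only [map_sub, sub_apply]
  rw [hs U W, hW, hW]
  ring

variable {T : H →L[ℝ] X} {B : ℕ → H →L[ℝ] H →L[ℝ] ℝ} {Binf : H →L[ℝ] H →L[ℝ] ℝ} {c : ℝ}

/-- A violation yields a subsequence of bounded energy, hence by coercivity a weak limit `U₀` lying
over `x`. Comparison with the solutions for `f = Binf U₀` bounds the energies below by expressions
linear in the sequence, which pass to the weak limit. -/
theorem quadEnergy_le_liminf [CompleteSpace H] [TopologicalSpace.SeparableSpace H]
    (hcpt : ∀ (u : ℕ → H) (u₀ : H), WeakTendsto u u₀ → Tendsto (fun k => T (u k)) atTop (𝓝 (T u₀)))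
    (hc : 0 < c) (hB : ∀ h u, c * ‖u‖ ^ 2 ≤ B h u u)
    (hBs : ∀ h u v, B h u v = B h v u)
    (hG : ∀ (f : StrongDual ℝ H) (u : ℕ → H) (uinf : H), (∀ h V, B h (u h) V = f V) →
      (∀ V, Binf uinf V = f V) → WeakTendsto u uinf)
    {x : X} {xs : ℕ → X} (hx : Tendsto xs atTop (𝓝 x)) :
    quadEnergy T Binf x ≤ liminf (fun h => quadEnergy T (B h) (xs h)) atTop := by
  by_contra! hlt
  obtain ⟨b, hb1, hb2⟩ := exists_between hlt
  have hb : b ≠ ⊤ := hb2.ne_top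
  obtain ⟨φ, hφ, hφb⟩ := extraction_of_frequently_atTop (frequently_lt_of_liminf_lt
    (by isBoundedDefault) hb1)
  choose U hU1 hU2 using fun k => exists_of_quadEnergy_lt (hφb k)
  have hUb : ∀ k, (1 / 2) * B (φ k) (U k) (U k) ≤ b.toReal := by
    intro k
    have := (ENNReal.ofReal_lt_iff_lt_toReal (by nlinarith [hB (φ k) (U k), sq_nonneg ‖U k‖]) hb).1
      (hU2 k)
    exact this.le
  have hbd : ∀ k, ‖U k‖ ≤ Real.sqrt (2 * b.toReal / c) := by
    intro k
    refine Real.le_sqrt_of_sq_le ?_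
    rw [le_div_iff₀ hc]
    nlinarith [hUb k, hB (φ k) (U k)]
  obtain ⟨U₀, θ, hθ, hw⟩ := exists_weakTendsto_subseq U _ hbd
  have hTU : T U₀ = x := by
    refine tendsto_nhds_unique (hcpt _ _ hw) ?_
    simp only [Function.comp_apply, hU1]
    exact hx.comp (hφ.tendsto_atTop.comp hθ.tendsto_atTop)
  choose W hW using fun h => exists_solution hc (hB h) (Binf U₀)
  have hWw := hG (Binf U₀) W U₀ hW (fun V => rfl)
  have h1 : Tendsto (fun k => Binf U₀ (U (θ k)) - (1 / 2) * Binf U₀ (W (φ (θ k)))) atTop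
      (𝓝 (Binf U₀ U₀ - (1 / 2) * Binf U₀ U₀)) :=
    (hw (Binf U₀)).sub (((hWw (Binf U₀)).comp
      (hφ.tendsto_atTop.comp hθ.tendsto_atTop)).const_mul _)
  -- The square `B (U - W) (U - W)` is nonnegative, so `f U - ½ f W ≤ ½ B U U ≤ b` along the
  -- subsequence.
  have h2 : Binf U₀ U₀ - (1 / 2) * Binf U₀ U₀ ≤ b.toReal := by
    refine le_of_tendsto h1 (Eventually.of_forall fun k => ?_)
    have e := form_sub_sub (hBs (φ (θ k))) (hW (φ (θ k))) (U (θ k))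
    have := hB (φ (θ k)) (U (θ k) - W (φ (θ k)))
    nlinarith [hUb (θ k), sq_nonneg ‖U (θ k) - W (φ (θ k))‖]
  have h3 : quadEnergy T Binf x ≤ b := by
    rw [← hTU]
    refine (quadEnergy_le T Binf U₀).trans (ENNReal.ofReal_le_of_le_toReal ?_)
    linarith
  exact absurd hb2 h3.not_gt

/-- The recovery sequence consists of the solutions for `f = Binf U`: their energy is `½ f (W h)`, a
weakly continuous quantity, and compactness makes their images converge in norm. -/
theorem exists_recovery [CompleteSpace H]
    (hcpt : ∀ (u : ℕ → H) (u₀ : H), WeakTendsto u u₀ → Tendsto (fun k => T (u k)) atTop (𝓝 (T u₀)))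
    (hinj : Function.Injective T)
    (hc : 0 < c) (hB : ∀ h u, c * ‖u‖ ^ 2 ≤ B h u u)
    (hG : ∀ (f : StrongDual ℝ H) (u : ℕ → H) (uinf : H), (∀ h V, B h (u h) V = f V) →
      (∀ V, Binf uinf V = f V) → WeakTendsto u uinf) (x : X) :
    ∃ ys : ℕ → X, Tendsto ys atTop (𝓝 x) ∧
      limsup (fun h => quadEnergy T (B h) (ys h)) atTop ≤ quadEnergy T Binf x := by
  by_cases hx : quadEnergy T Binf x < ⊤
  · obtain ⟨U, rfl, -⟩ := exists_of_quadEnergy_lt hx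
    choose W hW using fun h => exists_solution hc (hB h) (Binf U)
    have hWw := hG (Binf U) W U hW (fun V => rfl)
    refine ⟨fun h => T (W h), hcpt _ _ hWw, ?_⟩
    have h1 : Tendsto (fun h => ENNReal.ofReal ((1 / 2) * Binf U (W h))) atTop
        (𝓝 (ENNReal.ofReal ((1 / 2) * Binf U U))) :=
      ENNReal.tendsto_ofReal ((hWw (Binf U)).const_mul _)
    rw [quadEnergy_apply hinj, ← h1.limsup_eq]
    refine limsup_le_limsup (Eventually.of_forall fun h => ?_)
    simp only [← hW h]
    exact quadEnergy_le T (B h) (W h)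
  · exact ⟨fun _ => x, tendsto_const_nhds, by rw [not_lt_top_iff.1 hx]; exact le_top⟩

/-- The `Γ`-liminf inequality passes to subsequences. -/
theorem le_liminf_subseq {X : Type*} [NormedAddCommGroup X] {E : ℕ → X → ℝ≥0∞} {Einf : X → ℝ≥0∞}
    (hE : ∀ (x : X) (xs : ℕ → X), Tendsto xs atTop (𝓝 x) →
      Einf x ≤ liminf (fun h => E h (xs h)) atTop)
    {φ : ℕ → ℕ} (hφ : StrictMono φ) {x : X} {xs : ℕ → X} (hx : Tendsto xs atTop (𝓝 x)) :
    Einf x ≤ liminf (fun k => E (φ k) (xs k)) atTop := by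
  classical
  -- Indices outside the range of `φ` are filled with the limit `x`, so that the full sequence still
  -- converges.
  have ht : Tendsto (Function.extend φ xs (fun _ => x)) atTop (𝓝 x) := by
    intro s hs
    obtain ⟨N, hN⟩ := eventually_atTop.1 (hx hs)
    refine mem_map.2 (mem_atTop_sets.2 ⟨φ N, fun h hh => ?_⟩)
    by_cases hr : ∃ k, φ k = h
    · obtain ⟨k, rfl⟩ := hr
      rw [Set.mem_preimage, hφ.injective.extend_apply]
      exact hN k (hφ.le_iff_le.1 hh)
    · rw [Set.mem_preimage, Function.extend_apply' _ _ _ hr]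
      exact mem_of_mem_nhds hs
  refine (hE x _ ht).trans ?_
  have h2 : (fun k => E (φ k) (xs k)) =
      (fun h => E h (Function.extend φ xs (fun _ => x) h)) ∘ φ := by
    ext k
    simp [hφ.injective.extend_apply]
  rw [h2]
  exact hφ.tendsto_atTop.liminf_le_liminf_comp

/-- This is convergence of minimisers. As `f` factors through `T`, it can be evaluated along the
recovery sequence, which converges only in `X`. Every weak subsequential limit then minimises `½
Binf U U - f U`, whose minimiser is unique by coercivity. -/
theorem weakTendsto_of_gammaConverges_of_inner [CompleteSpace H]
    [TopologicalSpace.SeparableSpace H]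
    (hcpt : ∀ (u : ℕ → H) (u₀ : H), WeakTendsto u u₀ → Tendsto (fun k => T (u k)) atTop (𝓝 (T u₀)))
    (hinj : Function.Injective T)
    (hc : 0 < c) (hB : ∀ h u, c * ‖u‖ ^ 2 ≤ B h u u) (hBs : ∀ h u v, B h u v = B h v u)
    (hBinf : ∀ u, c * ‖u‖ ^ 2 ≤ Binf u u) (hBinfs : ∀ u v, Binf u v = Binf v u)
    (hΓ : GammaConverges (fun h => quadEnergy T (B h)) (quadEnergy T Binf))
    (f : StrongDual ℝ H) (g : X) (hfg : ∀ V, f V = inner ℝ g (T V))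
    (u : ℕ → H) (uinf : H) (hu : ∀ h V, B h (u h) V = f V)
    (huinf : ∀ V, Binf uinf V = f V) : WeakTendsto u uinf := by
  refine WeakTendsto.of_subseq fun φ hφ => ?_
  obtain ⟨W, θ, hθ, hw⟩ := exists_weakTendsto_subseq (u ∘ φ) _
    (fun k => norm_solution_le hc (hB (φ k)) (hu (φ k)))
  refine ⟨θ, ?_⟩
  suffices hWu : W = uinf by rw [← hWu]; exact hw
  obtain ⟨ys, hys, hlim⟩ := hΓ.2 (T uinf)
  have hliminf := le_liminf_subseq hΓ.1 (hφ.comp hθ) (hcpt _ _ hw)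
  rw [quadEnergy_apply hinj] at hliminf hlim
  have hgy : Tendsto (fun k => inner ℝ g (ys (φ (θ k)))) atTop (𝓝 (f uinf)) := by
    rw [hfg]
    exact (tendsto_const_nhds.inner hys).comp (hφ.comp hθ).tendsto_atTop
  -- Up to `ε`, this says that `W` does no worse than `uinf`. The slack makes the limsup bound
  -- strict, so that near-optimal competitors `V` over `ys` exist for large indices.
  have hmain : ∀ ε > 0, (1 / 2) * Binf W W ≤ (1 / 2) * Binf uinf uinf + ε - f uinf + f W := by
    intro ε hε
    have hpos : 0 ≤ (1 / 2) * Binf uinf uinf := by nlinarith [hBinf uinf, sq_nonneg ‖uinf‖]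
    have hev : ∀ᶠ h in atTop, quadEnergy T (B h) (ys h) <
        ENNReal.ofReal ((1 / 2) * Binf uinf uinf + ε) := by
      refine eventually_lt_of_limsup_lt (hlim.trans_lt ?_)
      exact (ENNReal.ofReal_lt_ofReal_iff (by linarith)).2 (by linarith)
    have hle : ∀ᶠ k in atTop, (1 / 2) * B (φ (θ k)) (u (φ (θ k))) (u (φ (θ k))) ≤
        (1 / 2) * Binf uinf uinf + ε - inner ℝ g (ys (φ (θ k))) + f (u (φ (θ k))) := by
      filter_upwards [(hφ.comp hθ).tendsto_atTop.eventually hev] with k hk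
      obtain ⟨V, hV1, hV2⟩ := exists_of_quadEnergy_lt hk
      have h3 := (ENNReal.ofReal_lt_ofReal_iff (by linarith)).1 hV2
      have h4 := form_sub_sub (hBs _) (hu (φ (θ k))) V
      have h5 := hB (φ (θ k)) (V - u (φ (θ k)))
      have h6 : 0 ≤ c * ‖V - u (φ (θ k))‖ ^ 2 := by positivity
      rw [hfg V, hV1] at h4
      rw [hu]
      simp only [Function.comp_apply] at h3 h4 ⊢
      linarith
    have htend : Tendsto (fun k => (1 / 2) * Binf uinf uinf + ε - inner ℝ g (ys (φ (θ k))) +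
        f (u (φ (θ k)))) atTop (𝓝 ((1 / 2) * Binf uinf uinf + ε - f uinf + f W)) :=
      (tendsto_const_nhds.sub hgy).add (hw f)
    -- Nonnegativity is needed to read the inequality in `ℝ≥0∞` back as one between reals.
    have hnn : 0 ≤ (1 / 2) * Binf uinf uinf + ε - f uinf + f W := by
      refine ge_of_tendsto htend (hle.mono fun k hk => le_trans ?_ hk)
      nlinarith [hB (φ (θ k)) (u (φ (θ k))), sq_nonneg ‖u (φ (θ k))‖]
    refine (ENNReal.ofReal_le_ofReal_iff hnn).1 (hliminf.trans ?_)
    rw [← (ENNReal.tendsto_ofReal htend).liminf_eq]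
    refine liminf_le_liminf (hle.mono fun k hk => ?_)
    exact (quadEnergy_le T _ _).trans (ENNReal.ofReal_le_ofReal hk)
  have h1 : (1 / 2) * Binf W W ≤ (1 / 2) * Binf uinf uinf - f uinf + f W :=
    le_of_forall_pos_le_add fun ε hε => by linarith [hmain ε hε]
  have h2 := form_sub_sub hBinfs huinf W
  have h3 := hBinf (W - uinf)
  rw [huinf] at h1
  have h4 : c * ‖W - uinf‖ ^ 2 ≤ 0 := by linarith
  have h5 : ‖W - uinf‖ ^ 2 ≤ 0 := by
    by_contra! h
    nlinarith
  have h6 : ‖W - uinf‖ = 0 := by nlinarith [norm_nonneg (W - uinf)]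
  exact sub_eq_zero.1 (norm_eq_zero.1 h6)

/-- Functionals of the form `⟪g, T ·⟫` are dense in the dual if `T` is injective. -/
theorem exists_inner_comp_near [CompleteSpace H] [CompleteSpace X] (hinj : Function.Injective T) (f : StrongDual ℝ H) {ε : ℝ}
    (hε : 0 < ε) : ∃ (g : X) (f' : StrongDual ℝ H), (∀ V, f' V = inner ℝ g (T V)) ∧
      ‖f - f'‖ < ε := by
  -- The orthogonal complement of the range of the adjoint is the kernel of `T`, which is trivial.
  have hd : (LinearMap.range T.adjoint.toLinearMap).topologicalClosure = ⊤ := by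
    rw [Submodule.topologicalClosure_eq_top_iff, ContinuousLinearMap.orthogonal_range,
      ContinuousLinearMap.adjoint_adjoint]
    exact LinearMap.ker_eq_bot.2 hinj
  have hmem : (InnerProductSpace.toDual ℝ H).symm f ∈
      closure (LinearMap.range T.adjoint.toLinearMap : Set H) := by
    rw [← Submodule.topologicalClosure_coe, hd]
    trivial
  obtain ⟨_, ⟨g, rfl⟩, hg⟩ := Metric.mem_closure_iff.1 hmem ε hε
  refine ⟨g, InnerProductSpace.toDual ℝ H (T.adjoint g), fun V => ?_, ?_⟩
  · rw [InnerProductSpace.toDual_apply_apply, ContinuousLinearMap.adjoint_inner_left]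
  · rw [dist_eq_norm] at hg
    rw [← (InnerProductSpace.toDual ℝ H).symm.norm_map, map_sub,
      LinearIsometryEquiv.symm_apply_apply]
    exact hg

/-- A general `f` is replaced by a nearby functional that factors through `T`. By coercivity the
solutions move by at most `‖f - f'‖ / c`, uniformly in `h`. -/
theorem weakTendsto_of_gammaConverges [CompleteSpace H] [CompleteSpace X]
    [TopologicalSpace.SeparableSpace H]
    (hcpt : ∀ (u : ℕ → H) (u₀ : H), WeakTendsto u u₀ → Tendsto (fun k => T (u k)) atTop (𝓝 (T u₀)))
    (hinj : Function.Injective T)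
    (hc : 0 < c) (hB : ∀ h u, c * ‖u‖ ^ 2 ≤ B h u u) (hBs : ∀ h u v, B h u v = B h v u)
    (hBinf : ∀ u, c * ‖u‖ ^ 2 ≤ Binf u u) (hBinfs : ∀ u v, Binf u v = Binf v u)
    (hΓ : GammaConverges (fun h => quadEnergy T (B h)) (quadEnergy T Binf))
    (f : StrongDual ℝ H) (u : ℕ → H) (uinf : H) (hu : ∀ h V, B h (u h) V = f V)
    (huinf : ∀ V, Binf uinf V = f V) : WeakTendsto u uinf := by
  intro G
  refine Metric.tendsto_atTop.2 fun ε hε => ?_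
  -- Each of the two replacements of `f` by `f'` then costs at most `ε / 4`, leaving `ε / 2` for the
  -- convergence; the `+ 1` covers `G = 0`.
  set δ : ℝ := ε * c / (4 * (‖G‖ + 1)) with hδ
  have hG1 : 0 < ‖G‖ + 1 := by positivity
  have hδ0 : 0 < δ := by positivity
  obtain ⟨g, f', hg, hf'⟩ := exists_inner_comp_near hinj f hδ0
  choose W hW using fun h => exists_solution hc (hB h) f'
  obtain ⟨Winf, hWinf⟩ := exists_solution hc hBinf f'
  have hw := weakTendsto_of_gammaConverges_of_inner hcpt hinj hc hB hBs hBinf hBinfs hΓ f' g hg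
    W Winf hW hWinf G
  obtain ⟨N, hN⟩ := Metric.tendsto_atTop.1 hw (ε / 2) (by positivity)
  refine ⟨N, fun h hh => ?_⟩
  have hclose : ∀ (B : H →L[ℝ] H →L[ℝ] ℝ), (∀ u, c * ‖u‖ ^ 2 ≤ B u u) → ∀ v w : H,
      (∀ V, B v V = f V) → (∀ V, B w V = f' V) → |G v - G w| ≤ ε / 4 := by
    intro B hB v w hv hw
    have h1 : ‖v - w‖ ≤ ‖f - f'‖ / c :=
      norm_solution_le hc hB (f := f - f') (fun V => by simp [hv, hw])
    have h2 : ‖v - w‖ ≤ δ / c := h1.trans (by gcongr)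
    have h3 : |G v - G w| ≤ ‖G‖ * ‖v - w‖ := by
      rw [← map_sub]
      exact G.le_opNorm _
    calc |G v - G w| ≤ (‖G‖ + 1) * (δ / c) := h3.trans (by gcongr; linarith)
      _ = ε / 4 := by rw [hδ]; field_simp
  have h1 := hclose (B h) (hB h) (u h) (W h) (hu h) (hW h)
  have h2 := hclose Binf hBinf uinf Winf huinf hWinf
  have h3 := hN h hh
  rw [Real.dist_eq] at h3 ⊢
  rw [abs_lt] at h3 ⊢
  rw [abs_le] at h1 h2
  constructor <;> linarith

/-- Weak convergence of solutions is equivalent to `Γ`-convergence of the energies, for uniformly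
coercive symmetric forms on a space that embeds compactly. -/
theorem weakTendsto_iff_gammaConverges [CompleteSpace H] [CompleteSpace X]
    [TopologicalSpace.SeparableSpace H]
    (hcpt : ∀ (u : ℕ → H) (u₀ : H), WeakTendsto u u₀ → Tendsto (fun k => T (u k)) atTop (𝓝 (T u₀)))
    (hinj : Function.Injective T)
    (hc : 0 < c) (hB : ∀ h u, c * ‖u‖ ^ 2 ≤ B h u u) (hBs : ∀ h u v, B h u v = B h v u)
    (hBinf : ∀ u, c * ‖u‖ ^ 2 ≤ Binf u u) (hBinfs : ∀ u v, Binf u v = Binf v u) :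
    (∀ (f : StrongDual ℝ H) (u : ℕ → H) (uinf : H), (∀ h V, B h (u h) V = f V) →
      (∀ V, Binf uinf V = f V) → WeakTendsto u uinf) ↔
    GammaConverges (fun h => quadEnergy T (B h)) (quadEnergy T Binf) :=
  ⟨fun hG => ⟨fun _ _ hx => quadEnergy_le_liminf hcpt hc hB hBs hG hx,
    fun x => exists_recovery hcpt hinj hc hB hG x⟩,
   fun hΓ f u uinf hu huinf =>
    weakTendsto_of_gammaConverges hcpt hinj hc hB hBs hBinf hBinfs hΓ f u uinf hu huinf⟩

end Abstract

/-! ### The Fourier symbol of the fractional gradient and its lower bound -/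

section Kernel

variable {n : ℕ} {s : ℝ}

/-- The integrable radial weight `|z| min(1, |z|) / |z|^(n+s+1)` that dominates all kernels. -/
noncomputable def kerWeight (s : ℝ) (z : Sp n) : ℝ :=
  ‖z‖ * min 1 ‖z‖ / ‖z‖ ^ ((n : ℝ) + s + 1)

/-- In polar coordinates the weight becomes `y ^ (-s)` on `(0, 1]`, integrable as `s < 1`, and `y ^
(-1 - s)` beyond, integrable as `s > 0`. -/
theorem integrable_kerWeight (hn : 0 < n) (hs : s ∈ Set.Ioo (0 : ℝ) 1) :
    Integrable (kerWeight s : Sp n → ℝ) := by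
  have : Nonempty (Fin n) := ⟨⟨0, hn⟩⟩
  have : Nontrivial (Sp n) := inferInstance
  have key := integrable_fun_norm_addHaar (volume : Measure (Sp n))
    (f := fun y : ℝ => y * min 1 y / y ^ ((n : ℝ) + s + 1))
  refine key.2 ?_
  rw [finrank_euclideanSpace_fin]
  have hpow : ∀ y : ℝ, 0 < y → y ^ (n - 1) * y = y ^ (n : ℝ) := by
    intro y hy
    rw [Real.rpow_natCast, ← pow_succ, Nat.sub_add_cancel hn]
  rw [← Set.Ioc_union_Ioi_eq_Ioi (zero_le_one' ℝ)]
  refine IntegrableOn.union ?_ ?_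
  · have h1 : IntegrableOn (fun y : ℝ => y ^ (-s)) (Set.Ioc 0 1) := by
      rw [← intervalIntegrable_iff_integrableOn_Ioc_of_le zero_le_one]
      exact intervalIntegral.intervalIntegrable_rpow' (by linarith [hs.2])
    refine h1.congr_fun (fun y hy => ?_) measurableSet_Ioc
    have hy0 : 0 < y := hy.1
    simp only [smul_eq_mul]
    rw [min_eq_right hy.2, ← mul_div_assoc, ← mul_assoc, hpow y hy0, eq_div_iff (by positivity),
      ← Real.rpow_add hy0, ← Real.rpow_add_one hy0.ne']
    congr 1; ring
  · have h1 : IntegrableOn (fun y : ℝ => y ^ (-1 - s)) (Set.Ioi 1) :=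
      integrableOn_Ioi_rpow_of_lt (by linarith [hs.1]) one_pos
    refine h1.congr_fun (fun y hy => ?_) measurableSet_Ioi
    have hy0 : 0 < y := zero_lt_one.trans hy
    simp only [smul_eq_mul]
    rw [min_eq_left (le_of_lt hy), mul_one, ← mul_div_assoc, hpow y hy0,
      eq_div_iff (by positivity), ← Real.rpow_add hy0]
    congr 1; ring

theorem integrable_of_norm_le_kerWeight {E : Type*} [NormedAddCommGroup E] (hn : 0 < n)
    (hs : s ∈ Set.Ioo (0 : ℝ) 1) {F : Sp n → E} (hF : AEStronglyMeasurable F volume) (C : ℝ)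
    (h : ∀ z, ‖F z‖ ≤ C * kerWeight s z) : Integrable F :=
  ((integrable_kerWeight hn hs).const_mul C).mono' hF (Eventually.of_forall h)

theorem min_one_mul_le {a t : ℝ} (ha : 0 ≤ a) (ht : 0 ≤ t) :
    min 1 (a * t) ≤ (1 + a) * min 1 t := by
  rcases le_total 1 t with h | h
  · rw [min_eq_left h]; exact (min_le_left _ _).trans (by linarith)
  · rw [min_eq_right h]; exact (min_le_right _ _).trans (by linarith)

/-- The phase `2π ⟪z, ξ⟫`. -/
noncomputable def phase (z ξ : Sp n) : ℝ := 2 * Real.pi * inner ℝ z ξ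

theorem abs_phase_le (z ξ : Sp n) : |phase z ξ| ≤ 2 * Real.pi * ‖ξ‖ * ‖z‖ := by
  rw [phase, abs_mul, abs_of_pos Real.two_pi_pos, mul_assoc (2 * Real.pi), mul_comm ‖ξ‖]
  gcongr
  exact abs_real_inner_le_norm z ξ

theorem continuous_phase (ξ : Sp n) : Continuous fun z : Sp n => phase z ξ := by
  unfold phase; fun_prop

theorem phase_smul_right (z ξ : Sp n) (r : ℝ) : phase z (r • ξ) = r * phase z ξ := by
  unfold phase; rw [real_inner_smul_right]; ring

theorem abs_mul_min_one_phase_le (z ξ : Sp n) :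
    |phase z ξ| * min 1 |phase z ξ| ≤
      2 * Real.pi * ‖ξ‖ * (1 + 2 * Real.pi * ‖ξ‖) * (‖z‖ * min 1 ‖z‖) := by
  have h1 := abs_phase_le z ξ
  have h2 : min 1 |phase z ξ| ≤ (1 + 2 * Real.pi * ‖ξ‖) * min 1 ‖z‖ :=
    (min_le_min_left 1 h1).trans (min_one_mul_le (by positivity) (norm_nonneg z))
  calc _ ≤ (2 * Real.pi * ‖ξ‖ * ‖z‖) * ((1 + 2 * Real.pi * ‖ξ‖) * min 1 ‖z‖) := by gcongr
    _ = _ := by ring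

theorem abs_one_sub_cos_le (t : ℝ) : |1 - Real.cos t| ≤ |t| * min 1 |t| := by
  have h0 : 0 ≤ 1 - Real.cos t := by linarith [Real.cos_le_one t]
  rw [abs_of_nonneg h0]
  have h1 := Real.one_sub_sq_div_two_le_cos (x := t)
  have h2 := Real.neg_one_le_cos t
  rcases le_total 1 |t| with h | h
  · rw [min_eq_left h, mul_one]
    rcases le_total 2 |t| with h' | h'
    · linarith
    · nlinarith [sq_abs t, abs_nonneg t]
  · rw [min_eq_right h]
    nlinarith [sq_abs t]

/-- Here `r` is the dilation factor when `cosInt` is differentiated along rays at `r = 1`; the range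
`|r| ≤ 2` contains the unit ball around `1`. -/
theorem abs_sin_mul_le (r t : ℝ) (hr : |r| ≤ 2) : |Real.sin (r * t) * t| ≤ 2 * (|t| * min 1 |t|) := by
  have h1 := Real.abs_sin_le_one (r * t)
  have h2 : |Real.sin (r * t)| ≤ 2 * |t| :=
    (Real.abs_sin_le_abs).trans (by rw [abs_mul]; gcongr)
  rw [abs_mul]
  have h3 : |Real.sin (r * t)| ≤ 2 * min 1 |t| := by
    rcases le_total 1 |t| with h | h
    · rw [min_eq_left h]; linarith
    · rwa [min_eq_right h]
  calc _ ≤ 2 * min 1 |t| * |t| := by gcongr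
    _ = _ := by ring

/-- The integral `∫ (1 - cos (2π ⟪z, ξ⟫)) / |z|^(n+s+1) dz`. -/
noncomputable def cosInt (s : ℝ) (ξ : Sp n) : ℝ :=
  ∫ z : Sp n, (1 - Real.cos (phase z ξ)) / ‖z‖ ^ ((n : ℝ) + s + 1)

/-- The integral `∫ sin (2π ⟪z, ξ⟫) 2π ⟪z, ξ⟫ / |z|^(n+s+1) dz`. -/
noncomputable def sinInt (s : ℝ) (ξ : Sp n) : ℝ :=
  ∫ z : Sp n, Real.sin (phase z ξ) * phase z ξ / ‖z‖ ^ ((n : ℝ) + s + 1)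

theorem norm_cosInt_integrand_le (s : ℝ) (z ξ : Sp n) :
    ‖(1 - Real.cos (phase z ξ)) / ‖z‖ ^ ((n : ℝ) + s + 1)‖ ≤
      2 * Real.pi * ‖ξ‖ * (1 + 2 * Real.pi * ‖ξ‖) * kerWeight s z := by
  rw [Real.norm_eq_abs, abs_div, abs_of_nonneg (by positivity : 0 ≤ ‖z‖ ^ ((n : ℝ) + s + 1)),
    kerWeight, ← mul_div_assoc]
  gcongr
  exact (abs_one_sub_cos_le _).trans (abs_mul_min_one_phase_le z ξ)

theorem norm_sinInt_integrand_le (s : ℝ) (z ξ : Sp n) {r : ℝ} (hr : |r| ≤ 2) :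
    ‖Real.sin (r * phase z ξ) * phase z ξ / ‖z‖ ^ ((n : ℝ) + s + 1)‖ ≤
      2 * (2 * Real.pi * ‖ξ‖ * (1 + 2 * Real.pi * ‖ξ‖)) * kerWeight s z := by
  rw [Real.norm_eq_abs, abs_div, abs_of_nonneg (by positivity : 0 ≤ ‖z‖ ^ ((n : ℝ) + s + 1)),
    kerWeight, ← mul_div_assoc]
  gcongr
  refine (abs_sin_mul_le _ _ hr).trans ?_
  rw [mul_assoc 2]
  exact mul_le_mul_of_nonneg_left (abs_mul_min_one_phase_le z ξ) zero_le_two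

theorem measurable_cosInt_integrand (s : ℝ) (ξ : Sp n) :
    Measurable fun z : Sp n => (1 - Real.cos (phase z ξ)) / ‖z‖ ^ ((n : ℝ) + s + 1) := by
  have := (continuous_phase ξ).measurable
  fun_prop

theorem measurable_sinInt_integrand (s : ℝ) (ξ : Sp n) (r : ℝ) :
    Measurable fun z : Sp n =>
      Real.sin (r * phase z ξ) * phase z ξ / ‖z‖ ^ ((n : ℝ) + s + 1) := by
  have := (continuous_phase ξ).measurable
  fun_prop

theorem integrable_cosInt_integrand (hn : 0 < n) (hs : s ∈ Set.Ioo (0 : ℝ) 1) (ξ : Sp n) :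
    Integrable fun z : Sp n => (1 - Real.cos (phase z ξ)) / ‖z‖ ^ ((n : ℝ) + s + 1) :=
  integrable_of_norm_le_kerWeight hn hs (measurable_cosInt_integrand s ξ).aestronglyMeasurable _
    (fun z => norm_cosInt_integrand_le s z ξ)

/-- Substitute `z ↦ r z`: the kernel contributes `r ^ (n + s + 1)` and the volume `r ^ (-n)`. -/
theorem cosInt_smul (s : ℝ) (ξ : Sp n) {r : ℝ} (hr : 0 < r) :
    cosInt s (r • ξ) = r ^ (1 + s) * cosInt s ξ := by
  have h := Measure.integral_comp_smul (volume : Measure (Sp n))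
    (fun z : Sp n => (1 - Real.cos (phase z ξ)) / ‖z‖ ^ ((n : ℝ) + s + 1)) r
  rw [finrank_euclideanSpace_fin, abs_of_pos (by positivity), smul_eq_mul] at h
  have hp : ∀ z : Sp n, phase (r • z) ξ = r * phase z ξ := fun z => by
    unfold phase; rw [real_inner_smul_left]; ring
  simp only [hp, norm_smul, Real.norm_eq_abs, abs_of_pos hr,
    Real.mul_rpow hr.le (norm_nonneg _)] at h
  have e : cosInt s (r • ξ) = r ^ ((n : ℝ) + s + 1) * ∫ z : Sp n,
      (1 - Real.cos (r * phase z ξ)) / (r ^ ((n : ℝ) + s + 1) * ‖z‖ ^ ((n : ℝ) + s + 1)) := by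
    rw [← integral_const_mul]
    refine integral_congr_ae (Eventually.of_forall fun z => ?_)
    simp only [phase_smul_right]
    have : r ^ ((n : ℝ) + s + 1) ≠ 0 := by positivity
    rw [← mul_div_assoc, mul_div_mul_left _ _ this]
  rw [e, h, ← mul_assoc]
  change _ * cosInt s ξ = _
  congr 1
  rw [← Real.rpow_natCast, ← Real.rpow_neg hr.le, ← Real.rpow_add hr]
  congr 1; ring

theorem cosInt_pos (hn : 0 < n) (hs : s ∈ Set.Ioo (0 : ℝ) 1) {ξ : Sp n} (hξ : ξ ≠ 0) :
    0 < cosInt s ξ := by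
  refine (integral_pos_iff_support_of_nonneg (fun z => ?_)
    (integrable_cosInt_integrand hn hs ξ)).2 ?_
  · have := Real.cos_le_one (phase z ξ)
    exact div_nonneg (by linarith) (by positivity)
  · have hopen : IsOpen {z : Sp n | Real.cos (phase z ξ) < 1} :=
      isOpen_lt (Real.continuous_cos.comp (continuous_phase ξ)) continuous_const
    have hξ2 : ‖ξ‖ ^ 2 ≠ 0 := by positivity
    -- At this point the phase equals `π`, so the cosine is `-1`.
    have hmem : ((2 * ‖ξ‖ ^ 2)⁻¹ • ξ) ∈ {z : Sp n | Real.cos (phase z ξ) < 1} := by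
      have : phase ((2 * ‖ξ‖ ^ 2)⁻¹ • ξ) ξ = Real.pi := by
        unfold phase
        rw [real_inner_smul_left, real_inner_self_eq_norm_sq]
        field_simp
      rw [Set.mem_ofPred_eq, this, Real.cos_pi]
      norm_num
    refine (hopen.measure_pos volume ⟨_, hmem⟩).trans_le (measure_mono fun z hz => ?_)
    have hz0 : z ≠ 0 := by
      rintro rfl
      simp [phase] at hz
    have : (0 : ℝ) < ‖z‖ ^ ((n : ℝ) + s + 1) := Real.rpow_pos_of_pos (norm_pos_iff.2 hz0) _
    have hz' : Real.cos (phase z ξ) < 1 := hz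
    exact (div_pos (by linarith) this).ne'

theorem continuousOn_cosInt (hn : 0 < n) (hs : s ∈ Set.Ioo (0 : ℝ) 1) :
    ContinuousOn (cosInt s) (Metric.sphere (0 : Sp n) 1) := by
  refine continuousOn_of_dominated (bound := fun z =>
    2 * Real.pi * 1 * (1 + 2 * Real.pi * 1) * kerWeight s z)
    (fun ξ _ => (measurable_cosInt_integrand s ξ).aestronglyMeasurable) (fun ξ hξ => ?_)
    ((integrable_kerWeight hn hs).const_mul _) (Eventually.of_forall fun z => ?_)
  · rw [mem_sphere_zero_iff_norm] at hξ
    refine Eventually.of_forall fun z => ?_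
    have := norm_cosInt_integrand_le s z ξ
    rwa [hξ] at this
  · unfold phase
    fun_prop

/-- The constant is the minimum over the compact unit sphere; homogeneity extends the bound to all
`ξ ≠ 0`. -/
theorem exists_cosInt_ge (hn : 0 < n) (hs : s ∈ Set.Ioo (0 : ℝ) 1) :
    ∃ K > 0, ∀ ξ : Sp n, ξ ≠ 0 → K * ‖ξ‖ ^ (1 + s) ≤ cosInt s ξ := by
  have : Nonempty (Fin n) := ⟨⟨0, hn⟩⟩
  have : Nontrivial (Sp n) := inferInstance
  obtain ⟨e, he, hmin⟩ := (isCompact_sphere (0 : Sp n) 1).exists_isMinOn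
    (NormedSpace.sphere_nonempty.2 zero_le_one) (continuousOn_cosInt hn hs)
  refine ⟨cosInt s e, cosInt_pos hn hs ?_, fun ξ hξ => ?_⟩
  · rintro rfl
    simp at he
  · have hpos : 0 < ‖ξ‖ := norm_pos_iff.2 hξ
    have h1 : cosInt s e ≤ cosInt s (‖ξ‖⁻¹ • ξ) := hmin (by
      simp [norm_smul, hpos.ne'])
    have h2 := cosInt_smul s (‖ξ‖⁻¹ • ξ) hpos
    rw [smul_inv_smul₀ hpos.ne'] at h2
    rw [h2, mul_comm]
    gcongr

/-- Euler's identity for the homogeneous function `cosInt`. -/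
theorem sinInt_eq (hn : 0 < n) (hs : s ∈ Set.Ioo (0 : ℝ) 1) (ξ : Sp n) :
    sinInt s ξ = (1 + s) * cosInt s ξ := by
  -- The derivative along the ray at `r = 1` is computed twice: under the integral sign here, and
  -- from homogeneity in `h2`.
  have h1 : HasDerivAt (fun r : ℝ => cosInt s (r • ξ)) (sinInt s ξ) 1 := by
    have := (hasDerivAt_integral_of_dominated_loc_of_deriv_le (μ := (volume : Measure (Sp n)))
      (F := fun (r : ℝ) (z : Sp n) =>
        (1 - Real.cos (phase z (r • ξ))) / ‖z‖ ^ ((n : ℝ) + s + 1))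
      (F' := fun (r : ℝ) (z : Sp n) =>
        Real.sin (r * phase z ξ) * phase z ξ / ‖z‖ ^ ((n : ℝ) + s + 1))
      (bound := fun z => 2 * (2 * Real.pi * ‖ξ‖ * (1 + 2 * Real.pi * ‖ξ‖)) * kerWeight s z)
      (x₀ := (1 : ℝ)) (Metric.ball_mem_nhds 1 one_pos)
      (Eventually.of_forall fun r => (measurable_cosInt_integrand s _).aestronglyMeasurable)
      (integrable_cosInt_integrand hn hs _)
      (measurable_sinInt_integrand s ξ 1).aestronglyMeasurable
      (Eventually.of_forall fun z r hr => norm_sinInt_integrand_le s z ξ ?_)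
      ((integrable_kerWeight hn hs).const_mul _)
      (Eventually.of_forall fun z r hr => ?_)).2
    · simp only [one_mul] at this
      exact this
    · rw [Metric.mem_ball, Real.dist_eq, abs_lt] at hr
      rw [abs_le]
      constructor <;> linarith
    · simp only [phase_smul_right]
      have := (((hasDerivAt_id r).mul_const (phase z ξ)).cos.const_sub 1).div_const
        (‖z‖ ^ ((n : ℝ) + s + 1))
      simpa using this
  have h2 : HasDerivAt (fun r : ℝ => cosInt s (r • ξ)) ((1 + s) * cosInt s ξ) 1 := by
    have h3 := (Real.hasDerivAt_rpow_const (x := 1) (p := 1 + s) (Or.inl one_ne_zero)).mul_const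
      (cosInt s ξ)
    simp only [Real.one_rpow, mul_one] at h3
    refine h3.congr_of_eventuallyEq ?_
    filter_upwards [lt_mem_nhds (zero_lt_one' ℝ)] with r hr
    exact cosInt_smul s ξ hr
  exact h1.unique h2

/-- The `i`-th component of the Fourier symbol of the fractional gradient, up to a constant:
`∫ (1 - e^(-2πi z·ξ)) z_i / |z|^(n+s+1) dz`. -/
noncomputable def symbol (s : ℝ) (i : Fin n) (ξ : Sp n) : ℂ :=
  ∫ z : Sp n, (1 - (Real.fourierChar (-(inner ℝ z ξ)) : ℂ)) *
    ((z i / ‖z‖ ^ ((n : ℝ) + s + 1) : ℝ) : ℂ)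

theorem fourierChar_neg_inner (z ξ : Sp n) :
    (Real.fourierChar (-(inner ℝ z ξ)) : ℂ) = Complex.exp (Complex.I * ((-phase z ξ : ℝ) : ℂ)) := by
  rw [Real.fourierChar_apply, phase]
  congr 1
  push_cast
  ring

theorem norm_one_sub_fourierChar_le (z ξ : Sp n) :
    ‖1 - (Real.fourierChar (-(inner ℝ z ξ)) : ℂ)‖ ≤ 2 * (1 + 2 * Real.pi * ‖ξ‖) * min 1 ‖z‖ := by
  have h1 : ‖1 - (Real.fourierChar (-(inner ℝ z ξ)) : ℂ)‖ ≤ 2 := by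
    refine (norm_sub_le _ _).trans ?_
    rw [norm_one, Circle.norm_coe]
    norm_num
  have h2 : ‖1 - (Real.fourierChar (-(inner ℝ z ξ)) : ℂ)‖ ≤ |phase z ξ| := by
    rw [norm_sub_rev, fourierChar_neg_inner]
    refine Real.norm_exp_I_mul_ofReal_sub_one_le.trans ?_
    rw [Real.norm_eq_abs, abs_neg]
  have h3 := h2.trans (abs_phase_le z ξ)
  have h4 := min_one_mul_le (a := 2 * Real.pi * ‖ξ‖) (by positivity) (norm_nonneg z)
  have h5 : ‖1 - (Real.fourierChar (-(inner ℝ z ξ)) : ℂ)‖ ≤ 2 * min 1 (2 * Real.pi * ‖ξ‖ * ‖z‖) := by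
    rcases le_total 1 (2 * Real.pi * ‖ξ‖ * ‖z‖) with h | h
    · rwa [min_eq_left h, mul_one]
    · rw [min_eq_right h]
      exact h3.trans (by linarith [h3, norm_nonneg (1 - (Real.fourierChar (-(inner ℝ z ξ)) : ℂ))])
  calc _ ≤ _ := h5
    _ ≤ 2 * ((1 + 2 * Real.pi * ‖ξ‖) * min 1 ‖z‖) := by gcongr
    _ = _ := by ring

theorem integrable_symbol_integrand (hn : 0 < n) (hs : s ∈ Set.Ioo (0 : ℝ) 1) (i : Fin n)
    (ξ : Sp n) : Integrable fun z : Sp n => (1 - (Real.fourierChar (-(inner ℝ z ξ)) : ℂ)) *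
      ((z i / ‖z‖ ^ ((n : ℝ) + s + 1) : ℝ) : ℂ) := by
  refine integrable_of_norm_le_kerWeight hn hs ?_ (2 * (1 + 2 * Real.pi * ‖ξ‖)) fun z => ?_
  · have h1 : Continuous fun z : Sp n => (Real.fourierChar (-(inner ℝ z ξ)) : ℂ) := by fun_prop
    have h2 : Measurable fun z : Sp n => ((z i / ‖z‖ ^ ((n : ℝ) + s + 1) : ℝ) : ℂ) := by
      fun_prop
    exact ((measurable_const.sub h1.measurable).mul h2).aestronglyMeasurable
  · rw [norm_mul, Complex.norm_real, Real.norm_eq_abs, abs_div,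
      abs_of_nonneg (by positivity : 0 ≤ ‖z‖ ^ ((n : ℝ) + s + 1)), kerWeight]
    have h1 := norm_one_sub_fourierChar_le z ξ
    have h2 : |z i| ≤ ‖z‖ := PiLp.norm_apply_le z i
    calc _ ≤ (2 * (1 + 2 * Real.pi * ‖ξ‖) * min 1 ‖z‖) * (‖z‖ / ‖z‖ ^ ((n : ℝ) + s + 1)) := by
          gcongr
      _ = _ := by ring

/-- Pairing with `ξ` turns the factors `z i` into `⟪z, ξ⟫`, and `1 - e^(-iθ)` has imaginary part
`sin θ`. This reduces a lower bound on the vector symbol to one on a scalar integral. -/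
theorem im_sum_symbol (hn : 0 < n) (hs : s ∈ Set.Ioo (0 : ℝ) 1) (ξ : Sp n) :
    2 * Real.pi * (∑ i, (ξ i : ℂ) * symbol s i ξ).im = sinInt s ξ := by
  have h1 : ∑ i, (ξ i : ℂ) * symbol s i ξ = ∫ z : Sp n, ∑ i, (ξ i : ℂ) *
      ((1 - (Real.fourierChar (-(inner ℝ z ξ)) : ℂ)) *
        ((z i / ‖z‖ ^ ((n : ℝ) + s + 1) : ℝ) : ℂ)) := by
    rw [integral_finsetSum _ (fun i _ => (integrable_symbol_integrand hn hs i ξ).const_mul _)]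
    simp only [integral_const_mul, symbol]
  have hint : Integrable fun z : Sp n => ∑ i, (ξ i : ℂ) *
      ((1 - (Real.fourierChar (-(inner ℝ z ξ)) : ℂ)) *
        ((z i / ‖z‖ ^ ((n : ℝ) + s + 1) : ℝ) : ℂ)) :=
    integrable_finsetSum _ (fun i _ => (integrable_symbol_integrand hn hs i ξ).const_mul _)
  have h2 := integral_im (𝕜 := ℂ) hint
  rw [h1]
  change 2 * Real.pi * RCLike.im (_ : ℂ) = _
  rw [← h2, ← integral_const_mul, sinInt]
  refine integral_congr_ae (Eventually.of_forall fun z => ?_)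
  have h3 : ∑ i, (ξ i : ℂ) * ((1 - (Real.fourierChar (-(inner ℝ z ξ)) : ℂ)) *
        ((z i / ‖z‖ ^ ((n : ℝ) + s + 1) : ℝ) : ℂ)) =
      (((inner ℝ z ξ) / ‖z‖ ^ ((n : ℝ) + s + 1) : ℝ) : ℂ) *
        (1 - (Real.fourierChar (-(inner ℝ z ξ)) : ℂ)) := by
    rw [PiLp.inner_apply, Finset.sum_div]
    push_cast
    rw [Finset.sum_mul]
    refine Finset.sum_congr rfl fun i _ => ?_
    simp
    ring
  have h4 : (1 - (Real.fourierChar (-(inner ℝ z ξ)) : ℂ)).im = Real.sin (phase z ξ) := by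
    rw [fourierChar_neg_inner, mul_comm, Complex.sub_im, Complex.exp_ofReal_mul_I_im]
    simp
  simp only
  rw [h3]
  change 2 * Real.pi * (_ : ℂ).im = _
  rw [Complex.im_ofReal_mul, h4, phase]
  ring

/-- The Fourier symbol of the fractional gradient is bounded below by a multiple of `|ξ|^s`. -/
theorem exists_symbol_ge (hn : 0 < n) (hs : s ∈ Set.Ioo (0 : ℝ) 1) :
    ∃ K > 0, ∀ ξ : Sp n, ξ ≠ 0 → K * (‖ξ‖ ^ s) ^ 2 ≤ ∑ i, ‖symbol s i ξ‖ ^ 2 := by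
  obtain ⟨K, hK, hcos⟩ := exists_cosInt_ge hn hs
  refine ⟨(K / (2 * Real.pi)) ^ 2, by positivity, fun ξ hξ => ?_⟩
  have hpos : 0 < ‖ξ‖ := norm_pos_iff.2 hξ
  have h1 := im_sum_symbol hn hs ξ
  rw [sinInt_eq hn hs] at h1
  have h2 : K * ‖ξ‖ ^ (1 + s) ≤ 2 * Real.pi * (∑ i, (ξ i : ℂ) * symbol s i ξ).im := by
    rw [h1]
    have := cosInt_pos hn hs hξ
    nlinarith [hcos ξ hξ, hs.1]
  have h3 : (∑ i, (ξ i : ℂ) * symbol s i ξ).im ≤ ∑ i, |ξ i| * ‖symbol s i ξ‖ := by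
    refine (le_abs_self _).trans ((Complex.abs_im_le_norm _).trans ((norm_sum_le _ _).trans ?_))
    simp
  -- Cauchy–Schwarz; cancelling `‖ξ‖ ^ 2` lowers the exponent from `1 + s` to `s`.
  have h4 : (∑ i, |ξ i| * ‖symbol s i ξ‖) ^ 2 ≤ ‖ξ‖ ^ 2 * ∑ i, ‖symbol s i ξ‖ ^ 2 := by
    refine (Finset.sum_mul_sq_le_sq_mul_sq _ _ _).trans_eq ?_
    rw [EuclideanSpace.norm_sq_eq]
    simp
  rw [Real.rpow_add hpos, Real.rpow_one] at h2
  have h5 : K / (2 * Real.pi) * (‖ξ‖ * ‖ξ‖ ^ s) ≤ ∑ i, |ξ i| * ‖symbol s i ξ‖ := by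
    refine le_trans ?_ h3
    rw [div_mul_eq_mul_div, div_le_iff₀ Real.two_pi_pos]
    linarith
  have h6 : (K / (2 * Real.pi) * (‖ξ‖ * ‖ξ‖ ^ s)) ^ 2 ≤ ‖ξ‖ ^ 2 * ∑ i, ‖symbol s i ξ‖ ^ 2 :=
    (pow_le_pow_left₀ (by positivity) h5 2).trans h4
  have h7 : ‖ξ‖ ^ 2 * ((K / (2 * Real.pi)) ^ 2 * (‖ξ‖ ^ s) ^ 2) ≤
      ‖ξ‖ ^ 2 * ∑ i, ‖symbol s i ξ‖ ^ 2 := by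
    refine le_trans (le_of_eq ?_) h6
    ring
  exact le_of_mul_le_mul_left h7 (by positivity)

end Kernel

/-! ### The fractional gradient of a test function as a Fourier multiplier -/

section FourierGrad

open scoped FourierTransform

variable {n : ℕ} {s : ℝ} {ψ : Sp n → ℝ}

/-- For `‖z‖ ≤ 1` the difference is at most `L ‖z‖` and vanishes off the 1-thickening of the
support; for larger `z` the triangle inequality suffices. -/
theorem exists_integral_abs_sub_le (hψ : ContDiff ℝ ((⊤ : ℕ∞) : WithTop ℕ∞) ψ)
    (hc : HasCompactSupport ψ) :
    ∃ C, ∀ z : Sp n, ∫ x, |ψ x - ψ (x - z)| ≤ C * min 1 ‖z‖ := by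
  obtain ⟨L, hL⟩ := (hψ.of_le (by simp)).lipschitzWith_of_hasCompactSupport hc one_ne_zero
  have hint : Integrable ψ := hψ.continuous.integrable_of_hasCompactSupport hc
  set S := Metric.cthickening 1 (tsupport ψ) with hS
  have hScpt : IsCompact S := hc.isCompact.cthickening
  have hfin : volume S < ⊤ := hScpt.measure_lt_top
  have hmeas : MeasurableSet S := hScpt.measurableSet
  refine ⟨max (L * volume.real S) (2 * ∫ x, |ψ x|), fun z => ?_⟩
  rcases le_total ‖z‖ 1 with h | h
  · rw [min_eq_right h]
    have hb : ∀ x, |ψ x - ψ (x - z)| ≤ S.indicator (fun _ => L * ‖z‖) x := by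
      intro x
      by_cases hx : x ∈ S
      · rw [Set.indicator_of_mem hx]
        have := hL.dist_le_mul x (x - z)
        rwa [Real.dist_eq, dist_eq_norm, sub_sub_cancel] at this
      · rw [Set.indicator_of_notMem hx]
        have h1 : ψ x = 0 := image_eq_zero_of_notMem_tsupport fun hx' =>
          hx (Metric.self_subset_cthickening _ hx')
        have h2 : ψ (x - z) = 0 := image_eq_zero_of_notMem_tsupport fun hx' =>
          hx (Metric.mem_cthickening_of_dist_le x (x - z) 1 _ hx' (by
            rw [dist_eq_norm, sub_sub_cancel]; exact h))
        simp [h1, h2]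
    calc ∫ x, |ψ x - ψ (x - z)| ≤ ∫ x, S.indicator (fun _ => L * ‖z‖) x := by
          refine integral_mono_of_nonneg (Eventually.of_forall fun x => abs_nonneg _) ?_
            (Eventually.of_forall hb)
          exact (integrable_indicator_iff hmeas).2 (integrableOn_const hfin.ne)
      _ = (L * volume.real S) * ‖z‖ := by
          rw [integral_indicator hmeas, setIntegral_const, smul_eq_mul]; ring
      _ ≤ _ := by gcongr; exact le_max_left _ _
  · rw [min_eq_left h, mul_one]
    have h1 : Integrable fun x => |ψ (x - z)| := (hint.comp_sub_right z).abs
    calc ∫ x, |ψ x - ψ (x - z)| ≤ ∫ x, (|ψ x| + |ψ (x - z)|) :=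
          integral_mono_of_nonneg (Eventually.of_forall fun x => abs_nonneg _)
            (hint.abs.add h1) (Eventually.of_forall fun x => abs_sub _ _)
      _ = 2 * ∫ x, |ψ x| := by
          rw [integral_add hint.abs h1, integral_sub_right_eq_self (fun x => |ψ x|)]; ring
      _ ≤ _ := le_max_right _ _

/-- Integrating in `x` first leaves a multiple of `kerWeight`. This licenses the exchange of
integrals in the Fourier transform of the gradient. -/
theorem integrable_prod_gradKernel (hn : 0 < n) (hs : s ∈ Set.Ioo (0 : ℝ) 1)
    (hψ : ContDiff ℝ ((⊤ : ℕ∞) : WithTop ℕ∞) ψ) (hc : HasCompactSupport ψ) :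
    Integrable (fun p : Sp n × Sp n =>
      ((ψ p.1 - ψ (p.1 - p.2)) / ‖p.2‖ ^ ((n : ℝ) + s + 1)) • p.2) (volume.prod volume) := by
  have hint : Integrable ψ := hψ.continuous.integrable_of_hasCompactSupport hc
  have hcont := hψ.continuous
  have hmeas : AEStronglyMeasurable (fun p : Sp n × Sp n =>
      ((ψ p.1 - ψ (p.1 - p.2)) / ‖p.2‖ ^ ((n : ℝ) + s + 1)) • p.2) (volume.prod volume) := by
    have h1 : Measurable fun p : Sp n × Sp n => ψ p.1 - ψ (p.1 - p.2) :=
      (by fun_prop : Continuous fun p : Sp n × Sp n => ψ p.1 - ψ (p.1 - p.2)).measurable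
    exact (by fun_prop : Measurable fun p : Sp n × Sp n =>
      ((ψ p.1 - ψ (p.1 - p.2)) / ‖p.2‖ ^ ((n : ℝ) + s + 1)) • p.2).aestronglyMeasurable
  obtain ⟨C, hC⟩ := exists_integral_abs_sub_le hψ hc
  refine (integrable_prod_iff' hmeas).2 ⟨Eventually.of_forall fun z => ?_, ?_⟩
  · have h1 : Integrable fun x => ψ x - ψ (x - z) := hint.sub (hint.comp_sub_right z)
    exact (h1.div_const (‖z‖ ^ ((n : ℝ) + s + 1))).smul_const z
  · refine integrable_of_norm_le_kerWeight hn hs hmeas.norm.prod_swap.integral_prod_right' C fun z => ?_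
    have e : ∀ x, ‖((ψ x - ψ (x - z)) / ‖z‖ ^ ((n : ℝ) + s + 1)) • z‖ =
        |ψ x - ψ (x - z)| * (‖z‖ / ‖z‖ ^ ((n : ℝ) + s + 1)) := by
      intro x
      rw [norm_smul, Real.norm_eq_abs, abs_div,
        abs_of_nonneg (by positivity : 0 ≤ ‖z‖ ^ ((n : ℝ) + s + 1))]
      ring
    simp only [e]
    rw [integral_mul_const, Real.norm_eq_abs, abs_of_nonneg (by positivity), kerWeight]
    calc _ ≤ (C * min 1 ‖z‖) * (‖z‖ / ‖z‖ ^ ((n : ℝ) + s + 1)) := by gcongr; exact hC z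
      _ = _ := by ring

/-- The constant in front of the fractional gradient. -/
noncomputable def gradConst (n : ℕ) (s : ℝ) : ℝ := ((n : ℝ) - 1 + s) / rieszConst n (1 - s)

theorem gradConst_pos (hn : 0 < n) (hs : s ∈ Set.Ioo (0 : ℝ) 1) : 0 < gradConst n s := by
  have h1 : (1 : ℝ) ≤ n := by exact_mod_cast hn
  have h2 := hs.1
  have h3 := hs.2
  have g1 : 0 < Real.Gamma ((1 - s) / 2) := Real.Gamma_pos_of_pos (by linarith)
  have g2 : 0 < Real.Gamma (((n : ℝ) - (1 - s)) / 2) := Real.Gamma_pos_of_pos (by linarith)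
  unfold gradConst rieszConst
  have : 0 < (n : ℝ) - 1 + s := by linarith
  positivity

theorem fracGrad_eq_integral_translate (s : ℝ) (ψ : Sp n → ℝ) (x : Sp n) :
    fracGrad s ψ x = gradConst n s •
      ∫ z : Sp n, ((ψ x - ψ (x - z)) / ‖z‖ ^ ((n : ℝ) + s + 1)) • z := by
  rw [← integral_sub_left_eq_self (fun z : Sp n =>
    ((ψ x - ψ (x - z)) / ‖z‖ ^ ((n : ℝ) + s + 1)) • z) volume x]
  simp only [sub_sub_cancel]
  rfl

theorem fracGrad_apply_ae (hn : 0 < n) (hs : s ∈ Set.Ioo (0 : ℝ) 1)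
    (hψ : ContDiff ℝ ((⊤ : ℕ∞) : WithTop ℕ∞) ψ) (hc : HasCompactSupport ψ) (i : Fin n) :
    (fun x => ((fracGrad s ψ x i : ℝ) : ℂ)) =ᵐ[volume] fun x => (gradConst n s : ℂ) *
      ∫ z : Sp n, ((ψ x : ℂ) - ψ (x - z)) * ((z i / ‖z‖ ^ ((n : ℝ) + s + 1) : ℝ) : ℂ) := by
  filter_upwards [(integrable_prod_gradKernel hn hs hψ hc).prod_right_ae] with x hx
  rw [fracGrad_eq_integral_translate, PiLp.smul_apply, smul_eq_mul, Complex.ofReal_mul]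
  congr 1
  have h := (Complex.ofRealCLM.comp (EuclideanSpace.proj (𝕜 := ℝ) i)).integral_comp_comm hx
  refine Eq.trans h.symm (integral_congr_ae (Eventually.of_forall fun z => ?_))
  simp
  ring

theorem integrable_prod_gradKernel_apply (hn : 0 < n) (hs : s ∈ Set.Ioo (0 : ℝ) 1)
    (hψ : ContDiff ℝ ((⊤ : ℕ∞) : WithTop ℕ∞) ψ) (hc : HasCompactSupport ψ) (i : Fin n) :
    Integrable (fun p : Sp n × Sp n => ((ψ p.1 : ℂ) - ψ (p.1 - p.2)) *
      ((p.2 i / ‖p.2‖ ^ ((n : ℝ) + s + 1) : ℝ) : ℂ)) (volume.prod volume) := by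
  have h := (Complex.ofRealCLM.comp (EuclideanSpace.proj (𝕜 := ℝ) i)).integrable_comp
    (integrable_prod_gradKernel hn hs hψ hc)
  refine h.congr (Eventually.of_forall fun p => ?_)
  simp
  ring

theorem integrable_fracGrad_apply (hn : 0 < n) (hs : s ∈ Set.Ioo (0 : ℝ) 1)
    (hψ : ContDiff ℝ ((⊤ : ℕ∞) : WithTop ℕ∞) ψ) (hc : HasCompactSupport ψ) (i : Fin n) :
    Integrable (fun x => ((fracGrad s ψ x i : ℝ) : ℂ)) :=
  ((integrable_prod_gradKernel_apply hn hs hψ hc i).integral_prod_left.const_mul _).congr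
    (fracGrad_apply_ae hn hs hψ hc i).symm

/-- The Fourier transform of a translation difference. -/
theorem fourier_sub_translate {f : Sp n → ℂ} (hf : Integrable f) (z ξ : Sp n) :
    ∫ x, Real.fourierChar (-(inner ℝ x ξ)) • (f x - f (x - z)) =
      (1 - (Real.fourierChar (-(inner ℝ z ξ)) : ℂ)) * 𝓕 f ξ := by
  have h1 : Integrable fun x => Real.fourierChar (-(inner ℝ x ξ)) • f x :=
    (Real.fourierIntegral_convergent_iff ξ).2 hf
  have h2 : Integrable fun x => Real.fourierChar (-(inner ℝ x ξ)) • f (x - z) :=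
    (Real.fourierIntegral_convergent_iff ξ).2 (hf.comp_sub_right z)
  simp only [smul_sub]
  rw [integral_sub h1 h2, sub_mul, one_mul, Real.fourier_eq]
  congr 1
  rw [← integral_add_right_eq_self _ z, ← integral_const_mul]
  refine integral_congr_ae (Eventually.of_forall fun x => ?_)
  simp only [add_sub_cancel_right, inner_add_left, neg_add, AddChar.map_add_eq_mul,
    Circle.smul_def, Circle.coe_mul, smul_eq_mul]
  ring

/-- By Fubini the transform in `x` acts first on the translation difference, producing the factor `1
- e^(-2πi z·ξ)`; the remaining `z`-integral is the symbol. -/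
theorem fourier_fracGrad_apply (hn : 0 < n) (hs : s ∈ Set.Ioo (0 : ℝ) 1)
    (hψ : ContDiff ℝ ((⊤ : ℕ∞) : WithTop ℕ∞) ψ) (hc : HasCompactSupport ψ) (i : Fin n)
    (ξ : Sp n) :
    𝓕 (fun x => ((fracGrad s ψ x i : ℝ) : ℂ)) ξ =
      gradConst n s * symbol s i ξ * 𝓕 (fun x => (ψ x : ℂ)) ξ := by
  have hint : Integrable fun x => (ψ x : ℂ) :=
    (hψ.continuous.integrable_of_hasCompactSupport hc).ofReal
  have hprod : Integrable (fun p : Sp n × Sp n => Real.fourierChar (-(inner ℝ p.1 ξ)) •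
      (((ψ p.1 : ℂ) - ψ (p.1 - p.2)) * ((p.2 i / ‖p.2‖ ^ ((n : ℝ) + s + 1) : ℝ) : ℂ)))
      (volume.prod volume) := by
    have h1 := integrable_prod_gradKernel_apply hn hs hψ hc i
    have hcont : Continuous fun p : Sp n × Sp n =>
      (Real.fourierChar (-(inner ℝ p.1 ξ)) : ℂ) := by fun_prop
    refine h1.mono (hcont.aestronglyMeasurable.mul h1.aestronglyMeasurable) ?_
    exact Eventually.of_forall fun p => by rw [Circle.norm_smul]
  rw [Real.fourier_eq]
  calc ∫ x, Real.fourierChar (-(inner ℝ x ξ)) • ((fracGrad s ψ x i : ℝ) : ℂ)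
      = ∫ x, (gradConst n s : ℂ) * ∫ z : Sp n, Real.fourierChar (-(inner ℝ x ξ)) •
          (((ψ x : ℂ) - ψ (x - z)) * ((z i / ‖z‖ ^ ((n : ℝ) + s + 1) : ℝ) : ℂ)) := by
        refine integral_congr_ae ?_
        filter_upwards [fracGrad_apply_ae hn hs hψ hc i] with x hx
        rw [hx]
        simp only [Circle.smul_def, smul_eq_mul]
        rw [integral_const_mul]
        ring
    _ = (gradConst n s : ℂ) * ∫ z : Sp n, ∫ x, Real.fourierChar (-(inner ℝ x ξ)) •
          (((ψ x : ℂ) - ψ (x - z)) * ((z i / ‖z‖ ^ ((n : ℝ) + s + 1) : ℝ) : ℂ)) := by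
        rw [integral_const_mul, integral_integral_swap hprod]
    _ = (gradConst n s : ℂ) * ∫ z : Sp n, (1 - (Real.fourierChar (-(inner ℝ z ξ)) : ℂ)) *
          ((z i / ‖z‖ ^ ((n : ℝ) + s + 1) : ℝ) : ℂ) * 𝓕 (fun x => (ψ x : ℂ)) ξ := by
        congr 1
        refine integral_congr_ae (Eventually.of_forall fun z => ?_)
        have h2 := fourier_sub_translate hint z ξ
        simp only [← smul_mul_assoc]
        rw [integral_mul_const, h2]
        ring
    _ = _ := by
        rw [integral_mul_const, symbol]
        ring

/-- The Fourier transform on `L²` agrees with the Fourier integral on `L¹ ∩ L²`. -/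
theorem fourier_Lp_ae_eq (f : Lp ℂ 2 (volume : Measure (Sp n))) (hf : Integrable f) :
    (𝓕 f : Lp ℂ 2 (volume : Measure (Sp n))) =ᵐ[volume] 𝓕 (f : Sp n → ℂ) := by
  have hcont : Continuous (𝓕 (f : Sp n → ℂ)) :=
    VectorFourier.fourierIntegral_continuous Real.continuous_fourierChar continuous_inner hf
  refine ae_eq_of_integral_contDiff_smul_eq
    ((Lp.memLp _).locallyIntegrable (by norm_num)) hcont.locallyIntegrable fun g hg hgc => ?_
  have hg₁ : HasCompactSupport (Complex.ofRealCLM ∘ g) := hgc.comp_left rfl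
  have hg₂ : ContDiff ℝ ((⊤ : ℕ∞) : WithTop ℕ∞) (Complex.ofRealCLM ∘ g) := by fun_prop
  set φ : SchwartzMap (Sp n) ℂ := hg₁.toSchwartzMap hg₂ with hφ
  -- Tested against a Schwartz function, both transforms move onto `φ`: the `L²` one as a tempered
  -- distribution (`h1`), the integral one by Fubini (`h2`).
  have h1 : ((𝓕 f : Lp ℂ 2 (volume : Measure (Sp n))) : TemperedDistribution (Sp n) ℂ) φ =
      (𝓕 (f : TemperedDistribution (Sp n) ℂ)) φ := by
    rw [Lp.fourier_toTemperedDistribution_eq]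
  rw [TemperedDistribution.fourier_apply, Lp.toTemperedDistribution_apply,
    Lp.toTemperedDistribution_apply] at h1
  have h2 := VectorFourier.integral_fourierIntegral_smul_eq_flip (μ := (volume : Measure (Sp n)))
    (ν := (volume : Measure (Sp n))) (L := innerₗ (Sp n)) Real.continuous_fourierChar
    continuous_inner φ.integrable hf
  rw [flip_innerₗ] at h2
  have h3 : ∀ x, φ x = (g x : ℂ) := fun x => by simp [hφ]
  calc _ = ∫ x, φ x • (𝓕 f : Lp ℂ 2 (volume : Measure (Sp n))) x := by simp [h3]
    _ = _ := h1
    _ = ∫ x, φ x • 𝓕 (f : Sp n → ℂ) x := h2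
    _ = _ := by simp [h3]

end FourierGrad

/-! ### Spectral description, Poincaré inequality and compact embedding -/

section Spectral

open scoped FourierTransform

variable {n : ℕ} {s : ℝ} {Ω : Set (Sp n)}

/-- The complex-valued version of a real `L²` function. -/
noncomputable def cplx : L2 n →L[ℝ] Lp ℂ 2 (volume : Measure (Sp n)) :=
  Complex.ofRealCLM.compLpL 2 volume

/-- The complex-valued version of the `i`-th component of an `L²` vector field. -/
noncomputable def cplxComp (i : Fin n) : L2Vec n →L[ℝ] Lp ℂ 2 (volume : Measure (Sp n)) :=
  (Complex.ofRealCLM.comp (EuclideanSpace.proj (𝕜 := ℝ) i)).compLpL 2 volume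

theorem cplx_ae (u : L2 n) : cplx u =ᵐ[volume] fun x => (u x : ℂ) :=
  Complex.ofRealCLM.coeFn_compLpL u

theorem cplxComp_ae (i : Fin n) (g : L2Vec n) :
    cplxComp i g =ᵐ[volume] fun x => ((g x i : ℝ) : ℂ) :=
  (Complex.ofRealCLM.comp (EuclideanSpace.proj (𝕜 := ℝ) i)).coeFn_compLpL g

theorem norm_sq_eq_integral {E : Type*} (𝕜 : Type*) [RCLike 𝕜] [NormedAddCommGroup E]
    [InnerProductSpace 𝕜 E] (f : Lp E 2 (volume : Measure (Sp n))) :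
    ‖f‖ ^ 2 = ∫ x, ‖f x‖ ^ 2 := by
  have h : (inner 𝕜 f f : 𝕜) = ((∫ x, ‖f x‖ ^ 2 : ℝ) : 𝕜) := by
    rw [L2.inner_def, ← integral_ofReal]
    refine integral_congr_ae (Eventually.of_forall fun x => ?_)
    simp [inner_self_eq_norm_sq_to_K]
  rw [inner_self_eq_norm_sq_to_K] at h
  exact_mod_cast h

theorem integrable_norm_sq {E : Type*} [NormedAddCommGroup E]
    (f : Lp E 2 (volume : Measure (Sp n))) : Integrable fun x => ‖f x‖ ^ 2 :=
  (Lp.memLp f).integrable_norm_pow two_ne_zero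

theorem norm_cplx (u : L2 n) : ‖cplx u‖ = ‖u‖ := by
  have h : ‖cplx u‖ ^ 2 = ‖u‖ ^ 2 := by
    rw [norm_sq_eq_integral ℂ, norm_sq_eq_integral ℝ]
    refine integral_congr_ae ?_
    filter_upwards [cplx_ae u] with x hx
    rw [hx, Complex.norm_real]
  exact (pow_left_inj₀ (norm_nonneg _) (norm_nonneg _) two_ne_zero).1 h

theorem sum_norm_sq_cplxComp (g : L2Vec n) : ∑ i, ‖cplxComp i g‖ ^ 2 = ‖g‖ ^ 2 := by
  simp only [norm_sq_eq_integral ℂ]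
  rw [norm_sq_eq_integral ℝ, ← integral_finsetSum _ (fun i _ => integrable_norm_sq _)]
  refine integral_congr_ae ?_
  have h : ∀ᵐ x, ∀ i, cplxComp i g x = ((g x i : ℝ) : ℂ) := ae_all_iff.2 fun i => cplxComp_ae i g
  filter_upwards [h] with x hx
  rw [EuclideanSpace.norm_sq_eq]
  refine Finset.sum_congr rfl fun i _ => ?_
  rw [hx i, Complex.norm_real]

/-- Being related by a pointwise multiplier is a closed condition. -/
theorem isClosed_setOf_ae_eq_mul {𝕜 : Type*} [RCLike 𝕜] (m : Sp n → 𝕜) :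
    IsClosed {p : Lp 𝕜 2 (volume : Measure (Sp n)) × Lp 𝕜 2 (volume : Measure (Sp n)) |
      p.2 =ᵐ[volume] fun ξ => m ξ * p.1 ξ} := by
  refine IsSeqClosed.isClosed fun p q hp hq => ?_
  have h1 : Tendsto (fun k => (p k).1) atTop (𝓝 q.1) := (continuous_fst.tendsto q).comp hq
  have h2 : Tendsto (fun k => (p k).2) atTop (𝓝 q.2) := (continuous_snd.tendsto q).comp hq
  -- Two successive extractions make both components converge almost everywhere, so no bound on `m`
  -- is required.
  obtain ⟨φ, hφ, hφ1⟩ := (tendstoInMeasure_of_tendsto_Lp h1).exists_seq_tendsto_ae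
  obtain ⟨θ, hθ, hθ1⟩ := (tendstoInMeasure_of_tendsto_Lp
    (h2.comp hφ.tendsto_atTop)).exists_seq_tendsto_ae
  have h3 : ∀ᵐ ξ, ∀ k, (p k).2 ξ = m ξ * (p k).1 ξ := ae_all_iff.2 hp
  filter_upwards [hφ1, hθ1, h3] with ξ a b e
  refine tendsto_nhds_unique b ?_
  simp only [Function.comp_apply, e]
  exact (a.comp hθ.tendsto_atTop).const_mul _

/-- The pairs `(u, g)` with `u = 0` outside `Ω` and `ĝ_i = c m_i û`, where `c m` is the Fourier
symbol of the fractional gradient. -/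
noncomputable def spectralPairs (s : ℝ) (Ω : Set (Sp n)) : Submodule ℝ (L2Pair n) where
  carrier := {U | (U.fst : Sp n → ℝ) =ᵐ[volume] (fun x => Ω.indicator 1 x * U.fst x) ∧
    ∀ i, (𝓕 (cplxComp i U.snd) : Lp ℂ 2 (volume : Measure (Sp n))) =ᵐ[volume]
      fun ξ => (gradConst n s * symbol s i ξ) *
        (𝓕 (cplx U.fst) : Lp ℂ 2 (volume : Measure (Sp n))) ξ}
  zero_mem' := by
    constructor
    · filter_upwards [Lp.coeFn_zero ℝ 2 (volume : Measure (Sp n))] with x hx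
      rw [WithLp.zero_fst, hx, Pi.zero_apply, mul_zero]
    · intro i
      have h0 : (𝓕 (0 : Lp ℂ 2 (volume : Measure (Sp n))) : Lp ℂ 2 (volume : Measure (Sp n))) = 0 :=
        (Lp.fourierTransformₗᵢ (Sp n) ℂ).map_zero
      simp only [WithLp.zero_fst, WithLp.zero_snd, map_zero, h0]
      filter_upwards [Lp.coeFn_zero ℂ 2 (volume : Measure (Sp n))] with x hx
      rw [hx, Pi.zero_apply, mul_zero]
  add_mem' := by
    rintro U V ⟨hU1, hU2⟩ ⟨hV1, hV2⟩
    constructor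
    · simp only [WithLp.add_fst]
      filter_upwards [hU1, hV1, Lp.coeFn_add U.fst V.fst] with x a b e
      rw [e, Pi.add_apply, mul_add, ← a, ← b]
    · intro i
      simp only [WithLp.add_fst, WithLp.add_snd, map_add, FourierTransform.fourier_add]
      filter_upwards [hU2 i, hV2 i, Lp.coeFn_add (𝓕 (cplxComp i U.snd)) (𝓕 (cplxComp i V.snd)),
        Lp.coeFn_add (𝓕 (cplx U.fst)) (𝓕 (cplx V.fst))] with ξ a b e e'
      rw [e, e', Pi.add_apply, Pi.add_apply, a, b, mul_add]
  smul_mem' := by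
    rintro r U ⟨hU1, hU2⟩
    have hr : ∀ f : Lp ℂ 2 (volume : Measure (Sp n)),
        (𝓕 (r • f) : Lp ℂ 2 (volume : Measure (Sp n))) = r • 𝓕 f :=
      fun f => ((Lp.fourierTransformₗᵢ (Sp n) ℂ).toLinearEquiv.toLinearMap.restrictScalars ℝ).map_smul r f
    constructor
    · simp only [WithLp.smul_fst]
      filter_upwards [hU1, Lp.coeFn_smul r U.fst] with x a e
      rw [e, Pi.smul_apply, smul_eq_mul, mul_left_comm, ← a]
    · intro i
      simp only [WithLp.smul_fst, WithLp.smul_snd, map_smul, hr]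
      filter_upwards [hU2 i, Lp.coeFn_smul r (𝓕 (cplxComp i U.snd)),
        Lp.coeFn_smul r (𝓕 (cplx U.fst))] with ξ a e e'
      rw [e, e', Pi.smul_apply, Pi.smul_apply, a, mul_smul_comm]

theorem isClosed_spectralPairs (s : ℝ) (Ω : Set (Sp n)) :
    IsClosed (spectralPairs s Ω : Set (L2Pair n)) := by
  have hfst : Continuous fun U : L2Pair n => U.fst := by fun_prop
  have hsnd : Continuous fun U : L2Pair n => U.snd := by fun_prop
  have hF : Continuous fun f : Lp ℂ 2 (volume : Measure (Sp n)) =>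
      (𝓕 f : Lp ℂ 2 (volume : Measure (Sp n))) := (Lp.fourierTransformₗᵢ (Sp n) ℂ).continuous
  have h1 := (isClosed_setOf_ae_eq_mul (Ω.indicator (1 : Sp n → ℝ))).preimage
    (hfst.prodMk hfst)
  have h2 : ∀ i, IsClosed {U : L2Pair n |
      (𝓕 (cplxComp i U.snd) : Lp ℂ 2 (volume : Measure (Sp n))) =ᵐ[volume]
      fun ξ => (gradConst n s * symbol s i ξ) *
        (𝓕 (cplx U.fst) : Lp ℂ 2 (volume : Measure (Sp n))) ξ} := fun i =>
    (isClosed_setOf_ae_eq_mul fun ξ => (gradConst n s * symbol s i ξ)).preimage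
      ((hF.comp (cplx.continuous.comp hfst)).prodMk
        (hF.comp ((cplxComp i).continuous.comp hsnd)))
  have h3 := h1.inter (isClosed_iInter h2)
  convert h3 using 1
  ext U
  simp [spectralPairs]

theorem testPairs_subset_spectralPairs (hn : 0 < n) (hs : s ∈ Set.Ioo (0 : ℝ) 1) :
    testPairs s Ω ⊆ (spectralPairs s Ω : Set (L2Pair n)) := by
  rintro U ⟨ψ, ⟨hψ, hc, hsupp⟩, hu, hg⟩
  constructor
  · filter_upwards [hu] with x hx
    by_cases hxΩ : x ∈ Ω
    · simp [hxΩ]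
    · rw [hx, image_eq_zero_of_notMem_tsupport fun h => hxΩ (hsupp h), mul_zero]
  · intro i
    have hu' : cplx U.fst =ᵐ[volume] fun x => (ψ x : ℂ) := by
      filter_upwards [cplx_ae U.fst, hu] with x a b
      rw [a, b]
    have hg' : cplxComp i U.snd =ᵐ[volume] fun x => ((fracGrad s ψ x i : ℝ) : ℂ) := by
      filter_upwards [cplxComp_ae i U.snd, hg] with x a b
      rw [a, b]
    have hψint : Integrable fun x => (ψ x : ℂ) :=
      (hψ.continuous.integrable_of_hasCompactSupport hc).ofReal
    have e1 := fourier_Lp_ae_eq (cplx U.fst) (hψint.congr hu'.symm)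
    have e2 := fourier_Lp_ae_eq (cplxComp i U.snd)
      ((integrable_fracGrad_apply hn hs hψ hc i).congr hg'.symm)
    have hcongr : ∀ {f g : Sp n → ℂ}, f =ᵐ[volume] g → ∀ ξ, 𝓕 f ξ = 𝓕 g ξ := by
      intro f g hfg ξ
      rw [Real.fourier_eq, Real.fourier_eq]
      refine integral_congr_ae ?_
      filter_upwards [hfg] with x hx
      rw [hx]
    filter_upwards [e1, e2] with ξ a b
    rw [a, b, hcongr hu', hcongr hg', fourier_fracGrad_apply hn hs hψ hc]

/-- The multiplier relation and the support condition are closed and linear, so they pass from test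
functions to the closure. Only this inclusion is needed. -/
theorem Hs0_le_spectralPairs (hn : 0 < n) (hs : s ∈ Set.Ioo (0 : ℝ) 1) :
    Hs0 s Ω ≤ spectralPairs s Ω :=
  Submodule.topologicalClosure_minimal _
    (Submodule.span_le.2 (testPairs_subset_spectralPairs hn hs)) (isClosed_spectralPairs s Ω)

/-- This is closability of the fractional gradient: a function determines its gradient through the
multiplier relation and Plancherel. -/
theorem snd_eq_zero_of_fst_eq_zero {U : L2Pair n} (hU : U ∈ spectralPairs s Ω)
    (h0 : U.fst = 0) : U.snd = 0 := by
  have hz : (𝓕 (0 : Lp ℂ 2 (volume : Measure (Sp n))) : Lp ℂ 2 (volume : Measure (Sp n))) = 0 :=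
    (Lp.fourierTransformₗᵢ (Sp n) ℂ).map_zero
  have h : ∀ i, ‖cplxComp i U.snd‖ = 0 := by
    intro i
    rw [← Lp.norm_fourier_eq, norm_eq_zero]
    refine Lp.ext ?_
    have h1 := hU.2 i
    rw [h0, map_zero, hz] at h1
    filter_upwards [h1, Lp.coeFn_zero ℂ 2 (volume : Measure (Sp n))] with ξ a b
    rw [a, b]
    simp
  have h2 := sum_norm_sq_cplxComp U.snd
  simp only [h, ne_eq, OfNat.ofNat_ne_zero, not_false_eq_true, zero_pow, Finset.sum_const_zero] at h2
  exact norm_eq_zero.1 (pow_eq_zero_iff two_ne_zero |>.1 h2.symm)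

/-- The character `x ↦ e^(2πi x·ξ)` cut off to `Ω`. -/
noncomputable def cutChar (Ω : Set (Sp n)) (ξ x : Sp n) : ℂ :=
  Ω.indicator (fun x => (Real.fourierChar (inner ℝ x ξ) : ℂ)) x

theorem memLp_cutChar (hΩ : MeasurableSet Ω) (hfin : volume Ω ≠ ⊤) (ξ : Sp n) :
    MemLp (cutChar Ω ξ) 2 (volume : Measure (Sp n)) := by
  unfold cutChar
  have hcont : Continuous fun x : Sp n => (Real.fourierChar (inner ℝ x ξ) : ℂ) := by fun_prop
  refine (memLp_indicator_iff_restrict hΩ).2 ?_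
  have : IsFiniteMeasure (volume.restrict Ω) := ⟨by simpa using hfin.lt_top⟩
  exact MemLp.of_bound hcont.aestronglyMeasurable 1
    (Eventually.of_forall fun x => (Circle.norm_coe _).le)

theorem norm_toLp_cutChar_sq (hΩ : MeasurableSet Ω) (hfin : volume Ω ≠ ⊤) (ξ : Sp n) :
    ‖(memLp_cutChar hΩ hfin ξ).toLp‖ ^ 2 = volume.real Ω := by
  rw [norm_sq_eq_integral ℂ]
  calc _ = ∫ x, Ω.indicator (fun _ => (1 : ℝ)) x := by
        refine integral_congr_ae ?_
        filter_upwards [(memLp_cutChar hΩ hfin ξ).coeFn_toLp] with x hx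
        rw [hx, cutChar]
        by_cases h : x ∈ Ω
        · rw [Set.indicator_of_mem h, Set.indicator_of_mem h, Circle.norm_coe, one_pow]
        · simp [h]
    _ = _ := by
        rw [integral_indicator hΩ, setIntegral_const, smul_eq_mul, mul_one]

/-- The Fourier transform of a function supported in `Ω` is given by the inner products with the
cut-off characters. -/
theorem fourier_cplx_ae_eq_inner (hΩ : MeasurableSet Ω) (hfin : volume Ω ≠ ⊤) {u : L2 n}
    (hu : (u : Sp n → ℝ) =ᵐ[volume] fun x => Ω.indicator 1 x * u x) :
    (𝓕 (cplx u) : Lp ℂ 2 (volume : Measure (Sp n))) =ᵐ[volume]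
      fun ξ => inner ℂ (memLp_cutChar hΩ hfin ξ).toLp (cplx u) := by
  have hint : Integrable (cplx u) := by
    have h1 : IntegrableOn (u : Sp n → ℝ) Ω := by
      have : IsFiniteMeasure (volume.restrict Ω) := ⟨by simpa using hfin.lt_top⟩
      exact ((Lp.memLp u).restrict Ω).integrable (by norm_num)
    have h2 : Integrable (Ω.indicator u) := (integrable_indicator_iff hΩ).2 h1
    refine h2.ofReal.congr ?_
    filter_upwards [cplx_ae u, hu] with x a b
    rw [a, b]
    by_cases h : x ∈ Ω <;> simp [h]
  filter_upwards [fourier_Lp_ae_eq (cplx u) hint] with ξ hξ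
  rw [hξ, Real.fourier_eq, L2.inner_def]
  refine integral_congr_ae ?_
  filter_upwards [cplx_ae u, hu, (memLp_cutChar hΩ hfin ξ).coeFn_toLp] with x a b e
  rw [e, a, cutChar, RCLike.inner_apply, Circle.smul_def, smul_eq_mul, mul_comm]
  by_cases h : x ∈ Ω
  · rw [Set.indicator_of_mem h, AddChar.map_neg_eq_inv, Circle.coe_inv_eq_conj]
  · rw [b]
    simp [h]

/-- High frequencies are controlled by the fractional gradient. -/
theorem exists_norm_sq_le_low_add_high (hn : 0 < n) (hs : s ∈ Set.Ioo (0 : ℝ) 1) :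
    ∃ K > 0, ∀ (Ω : Set (Sp n)) (U : L2Pair n), U ∈ spectralPairs s Ω → ∀ R > 0,
      ‖U.fst‖ ^ 2 ≤ (∫ ξ in Metric.ball 0 R,
        ‖(𝓕 (cplx U.fst) : Lp ℂ 2 (volume : Measure (Sp n))) ξ‖ ^ 2) +
        (K * (R ^ s) ^ 2)⁻¹ * ‖U.snd‖ ^ 2 := by
  obtain ⟨K, hK, hsym⟩ := exists_symbol_ge hn hs
  have hc := gradConst_pos hn hs
  refine ⟨gradConst n s ^ 2 * K, by positivity, fun Ω U hU R hR => ?_⟩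
  have hKR : 0 < gradConst n s ^ 2 * K * (R ^ s) ^ 2 := by positivity
  set f : Lp ℂ 2 (volume : Measure (Sp n)) := 𝓕 (cplx U.fst) with hf
  have e1 : ‖U.fst‖ ^ 2 = ∫ ξ, ‖f ξ‖ ^ 2 := by
    rw [← norm_cplx, ← Lp.norm_fourier_eq, norm_sq_eq_integral ℂ]
  have e2 : ‖U.snd‖ ^ 2 = ∫ ξ, ∑ i, ‖(𝓕 (cplxComp i U.snd) :
      Lp ℂ 2 (volume : Measure (Sp n))) ξ‖ ^ 2 := by
    rw [← sum_norm_sq_cplxComp, integral_finsetSum _ (fun i _ => integrable_norm_sq _)]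
    refine Finset.sum_congr rfl fun i _ => ?_
    rw [← Lp.norm_fourier_eq, norm_sq_eq_integral ℂ]
  have hint2 : Integrable fun ξ => ∑ i, ‖(𝓕 (cplxComp i U.snd) :
      Lp ℂ 2 (volume : Measure (Sp n))) ξ‖ ^ 2 :=
    integrable_finsetSum _ (fun i _ => integrable_norm_sq _)
  rw [e1, ← integral_add_compl (Metric.isOpen_ball (x := (0 : Sp n)) (ε := R)).measurableSet
    (integrable_norm_sq f), inv_mul_eq_div]
  gcongr
  rw [le_div_iff₀ hKR, mul_comm, ← integral_const_mul, e2]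
  refine le_trans ?_ (setIntegral_le_integral (s := (Metric.ball (0 : Sp n) R)ᶜ) hint2
    (Eventually.of_forall fun ξ => Finset.sum_nonneg fun i _ => by positivity))
  refine setIntegral_mono_on_ae ((integrable_norm_sq f).const_mul _).integrableOn
    hint2.integrableOn Metric.isOpen_ball.measurableSet.compl ?_
  have hall : ∀ᵐ ξ, ∀ i, (𝓕 (cplxComp i U.snd) : Lp ℂ 2 (volume : Measure (Sp n))) ξ =
      (gradConst n s * symbol s i ξ) * f ξ := ae_all_iff.2 hU.2
  filter_upwards [hall] with ξ hξ hR'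
  have hR2 : R ≤ ‖ξ‖ := by simpa using hR'
  have hξ0 : ξ ≠ 0 := norm_pos_iff.1 (hR.trans_le hR2)
  have e3 : ∑ i, ‖(𝓕 (cplxComp i U.snd) : Lp ℂ 2 (volume : Measure (Sp n))) ξ‖ ^ 2 =
      gradConst n s ^ 2 * (∑ i, ‖symbol s i ξ‖ ^ 2) * ‖f ξ‖ ^ 2 := by
    rw [Finset.mul_sum, Finset.sum_mul]
    refine Finset.sum_congr rfl fun i _ => ?_
    rw [hξ i, norm_mul, norm_mul, Complex.norm_real, Real.norm_eq_abs, abs_of_pos hc]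
    ring
  rw [e3, mul_assoc (gradConst n s ^ 2)]
  -- Outside the ball the symbol bound is at least its value at radius `R`.
  have h1 : R ^ s ≤ ‖ξ‖ ^ s := Real.rpow_le_rpow hR.le hR2 hs.1.le
  have h2 : K * (R ^ s) ^ 2 ≤ ∑ i, ‖symbol s i ξ‖ ^ 2 :=
    le_trans (by gcongr) (hsym ξ hξ0)
  gcongr

/-- Cauchy–Schwarz against the cut-off character, of squared norm `|Ω|`, bounds `û` pointwise. -/
theorem integral_ball_fourier_le (hΩ : MeasurableSet Ω) (hfin : volume Ω ≠ ⊤) {u : L2 n}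
    (hu : (u : Sp n → ℝ) =ᵐ[volume] fun x => Ω.indicator 1 x * u x) (R : ℝ) :
    ∫ ξ in Metric.ball 0 R, ‖(𝓕 (cplx u) : Lp ℂ 2 (volume : Measure (Sp n))) ξ‖ ^ 2 ≤
      volume.real (Metric.ball (0 : Sp n) R) * (volume.real Ω * ‖u‖ ^ 2) := by
  rw [← smul_eq_mul, ← setIntegral_const]
  refine setIntegral_mono_on_ae (integrable_norm_sq _).integrableOn
    (integrableOn_const measure_ball_lt_top.ne) Metric.isOpen_ball.measurableSet ?_
  filter_upwards [fourier_cplx_ae_eq_inner hΩ hfin hu] with ξ hξ _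
  rw [hξ, ← norm_toLp_cutChar_sq hΩ hfin ξ, ← norm_cplx u, ← mul_pow]
  gcongr
  exact norm_inner_le_norm _ _

/-- The Poincaré inequality. -/
theorem exists_poincare (hn : 0 < n) (hs : s ∈ Set.Ioo (0 : ℝ) 1) (hΩ : MeasurableSet Ω)
    (hfin : volume Ω ≠ ⊤) :
    ∃ C, ∀ U : L2Pair n, U ∈ spectralPairs s Ω → ‖U.fst‖ ^ 2 ≤ C * ‖U.snd‖ ^ 2 := by
  obtain ⟨K, hK, h⟩ := exists_norm_sq_le_low_add_high (n := n) hn hs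
  have hlim : Tendsto (fun R : ℝ => volume.real (Metric.ball (0 : Sp n) R) * volume.real Ω)
      (𝓝[>] 0) (𝓝 0) := by
    have h1 : ∀ R ∈ Set.Ioi (0 : ℝ), R ^ n * volume.real (Metric.ball (0 : Sp n) 1) *
        volume.real Ω = volume.real (Metric.ball (0 : Sp n) R) * volume.real Ω := by
      intro R hR
      rw [measureReal_def, measureReal_def (s := Metric.ball (0 : Sp n) R),
        Measure.addHaar_ball_of_pos volume (0 : Sp n) hR,
        finrank_euclideanSpace_fin, ENNReal.toReal_mul,
        ENNReal.toReal_ofReal (pow_nonneg (le_of_lt hR) n)]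
    refine Tendsto.congr' (eventually_nhdsWithin_of_forall h1) ?_
    have hcont : Continuous fun R : ℝ => R ^ n * volume.real (Metric.ball (0 : Sp n) 1) *
        volume.real Ω := by fun_prop
    have := (hcont.tendsto 0).mono_left (nhdsWithin_le_nhds (s := Set.Ioi 0))
    simpa [hn.ne'] using this
  -- A small `R` makes the low frequencies at most half of `‖u‖ ^ 2`, which is absorbed on the left.
  obtain ⟨R, hR1, hR2⟩ := ((hlim.eventually (gt_mem_nhds (half_pos one_pos))).and
    self_mem_nhdsWithin).exists
  refine ⟨2 * (K * (R ^ s) ^ 2)⁻¹, fun U hU => ?_⟩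
  have h1 := h Ω U hU R hR2
  have h2 := integral_ball_fourier_le hΩ hfin hU.1 R
  rw [← mul_assoc] at h2
  have h3 : volume.real (Metric.ball (0 : Sp n) R) * volume.real Ω * ‖U.fst‖ ^ 2 ≤
      1 / 2 * ‖U.fst‖ ^ 2 := by gcongr
  linarith

theorem WeakTendsto.exists_norm_le {H : Type*} [NormedAddCommGroup H] [InnerProductSpace ℝ H]
    [CompleteSpace H] {u : ℕ → H} {u₀ : H} (h : WeakTendsto u u₀) : ∃ M, ∀ k, ‖u k‖ ≤ M := by
  obtain ⟨M, hM⟩ := banach_steinhaus (g := fun k => innerSL ℝ (u k)) fun x => by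
    have h1 : Tendsto (fun k => inner ℝ x (u k)) atTop (𝓝 (inner ℝ x u₀)) := h (innerSL ℝ x)
    obtain ⟨C, hC⟩ := (Metric.isBounded_range_of_tendsto _ h1).exists_norm_le
    refine ⟨C, fun k => ?_⟩
    rw [innerSL_apply_apply, real_inner_comm]
    exact hC _ ⟨k, rfl⟩
  exact ⟨M, fun k => by simpa using hM k⟩

/-- Compactness of the embedding into `L²`, for sequences tending weakly to zero. -/
theorem tendsto_fst_zero_of_inner_tendsto (hn : 0 < n) (hs : s ∈ Set.Ioo (0 : ℝ) 1)
    (hΩ : MeasurableSet Ω) (hfin : volume Ω ≠ ⊤) {U : ℕ → L2Pair n}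
    (hU : ∀ k, U k ∈ spectralPairs s Ω) {M : ℝ} (hM : ∀ k, ‖U k‖ ≤ M)
    (hw : ∀ e : Lp ℂ 2 (volume : Measure (Sp n)),
      Tendsto (fun k => inner ℂ e (cplx (U k).fst)) atTop (𝓝 0)) :
    Tendsto (fun k => (U k).fst) atTop (𝓝 0) := by
  obtain ⟨K, hK, h⟩ := exists_norm_sq_le_low_add_high (n := n) hn hs
  have hM0 : 0 ≤ M := (norm_nonneg _).trans (hM 0)
  have hfst : ∀ k, ‖(U k).fst‖ ≤ M := fun k => (WithLp.norm_fst_le _ (U k)).trans (hM k)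
  have hsnd : ∀ k, ‖(U k).snd‖ ≤ M := fun k => (WithLp.norm_snd_le _ (U k)).trans (hM k)
  have hrep : ∀ᵐ ξ, ∀ k, (𝓕 (cplx (U k).fst) : Lp ℂ 2 (volume : Measure (Sp n))) ξ =
      inner ℂ (memLp_cutChar hΩ hfin ξ).toLp (cplx (U k).fst) :=
    ae_all_iff.2 fun k => fourier_cplx_ae_eq_inner hΩ hfin (hU k).1
  have hlow : ∀ R : ℝ, Tendsto (fun k => ∫ ξ in Metric.ball 0 R,
      ‖(𝓕 (cplx (U k).fst) : Lp ℂ 2 (volume : Measure (Sp n))) ξ‖ ^ 2) atTop (𝓝 0) := by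
    intro R
    -- For fixed `ξ` the transform is an inner product with a fixed vector, hence tends to zero;
    -- Cauchy–Schwarz gives a constant majorant on the ball.
    have hdct := tendsto_integral_of_dominated_convergence
      (μ := volume.restrict (Metric.ball (0 : Sp n) R))
      (F := fun k ξ => ‖(𝓕 (cplx (U k).fst) : Lp ℂ 2 (volume : Measure (Sp n))) ξ‖ ^ 2)
      (f := fun _ => 0) (fun _ => volume.real Ω * M ^ 2)
      (fun k => (integrable_norm_sq _).integrableOn.aestronglyMeasurable)
      (integrableOn_const measure_ball_lt_top.ne) (fun k => ?_) ?_
    · simpa using hdct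
    · refine ae_restrict_of_ae ?_
      filter_upwards [hrep] with ξ hξ
      rw [hξ k, ← norm_toLp_cutChar_sq hΩ hfin ξ, Real.norm_eq_abs, abs_of_nonneg (by positivity),
        ← mul_pow]
      gcongr
      refine (norm_inner_le_norm _ _).trans ?_
      gcongr
      rw [norm_cplx]
      exact hfst k
    · refine ae_restrict_of_ae ?_
      filter_upwards [hrep] with ξ hξ
      simp only [hξ]
      simpa using ((hw (memLp_cutChar hΩ hfin ξ).toLp).norm).pow 2
  have hhigh : Tendsto (fun R : ℝ => (K * (R ^ s) ^ 2)⁻¹ * M ^ 2) atTop (𝓝 0) := by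
    have h1 : Tendsto (fun R : ℝ => K * (R ^ s) ^ 2) atTop atTop :=
      ((tendsto_pow_atTop two_ne_zero).comp (tendsto_rpow_atTop hs.1)).const_mul_atTop hK
    simpa using h1.inv_tendsto_atTop.mul_const (M ^ 2)
  have hsq : Tendsto (fun k => ‖(U k).fst‖ ^ 2) atTop (𝓝 0) := by
    refine Metric.tendsto_atTop.2 fun ε hε => ?_
    -- The radius is fixed first, making the high frequencies small uniformly in `k`; `N` then
    -- depends on `R`.
    obtain ⟨R, hR1, hR2⟩ := ((hhigh.eventually (gt_mem_nhds (half_pos hε))).and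
      (eventually_gt_atTop 0)).exists
    obtain ⟨N, hN⟩ := eventually_atTop.1 ((hlow R).eventually (gt_mem_nhds (half_pos hε)))
    refine ⟨N, fun k hk => ?_⟩
    rw [Real.dist_eq, sub_zero, abs_of_nonneg (by positivity)]
    have h1 := h Ω (U k) (hU k) R hR2
    have h2 : (K * (R ^ s) ^ 2)⁻¹ * ‖(U k).snd‖ ^ 2 ≤ (K * (R ^ s) ^ 2)⁻¹ * M ^ 2 := by
      gcongr
      exact hsnd k
    linarith [hN k hk]
  rw [tendsto_zero_iff_norm_tendsto_zero]
  have := hsq.sqrt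
  simpa using this

/-- The embedding of `H^s_0(O)` into `L²`. -/
noncomputable def Hs0.toL2L (s : ℝ) (Ω : Set (Sp n)) : Hs0 s Ω →L[ℝ] L2 n :=
  (WithLp.fstL 2 ℝ (L2 n) (L2Vec n)).comp (Hs0 s Ω).subtypeL

theorem Hs0.toL2L_injective (hn : 0 < n) (hs : s ∈ Set.Ioo (0 : ℝ) 1) :
    Function.Injective (Hs0.toL2L s Ω) := by
  refine (injective_iff_map_eq_zero _).2 fun U hU => ?_
  have h1 : (U : L2Pair n).fst = 0 := hU
  have h2 := snd_eq_zero_of_fst_eq_zero (Hs0_le_spectralPairs hn hs U.2) h1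
  exact Subtype.ext (WithLp.ofLp_injective 2 (Prod.ext h1 h2))

theorem Hs0.toL2L_tendsto (hn : 0 < n) (hs : s ∈ Set.Ioo (0 : ℝ) 1) (hΩ : MeasurableSet Ω)
    (hfin : volume Ω ≠ ⊤) (u : ℕ → Hs0 s Ω) (u₀ : Hs0 s Ω) (h : WeakTendsto u u₀) :
    Tendsto (fun k => Hs0.toL2L s Ω (u k)) atTop (𝓝 (Hs0.toL2L s Ω u₀)) := by
  have : CompleteSpace (Hs0 s Ω) :=
    (Submodule.isClosed_topologicalClosure _).completeSpace_coe
  obtain ⟨M, hM⟩ := h.exists_norm_le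
  refine tendsto_sub_nhds_zero_iff.1 ?_
  refine tendsto_fst_zero_of_inner_tendsto hn hs hΩ hfin
    (U := fun k => ((u k - u₀ : Hs0 s Ω) : L2Pair n))
    (fun k => Hs0_le_spectralPairs hn hs (u k - u₀).2) (M := M + ‖u₀‖)
    (fun k => (norm_sub_le (u k) u₀).trans (by gcongr; exact hM k)) fun e => ?_
  -- Weak convergence is tested by real functionals, so it is applied to the real and imaginary
  -- parts of `G`.
  set G : Hs0 s Ω →L[ℝ] ℂ :=
    ((innerSL ℂ e).restrictScalars ℝ).comp (cplx.comp (Hs0.toL2L s Ω)) with hG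
  have hlim : Tendsto (fun k => G (u k)) atTop (𝓝 (G u₀)) := by
    have hre := h (Complex.reCLM.comp G)
    have him := h (Complex.imCLM.comp G)
    have := (Complex.continuous_ofReal.tendsto _).comp hre |>.add
      (((Complex.continuous_ofReal.tendsto _).comp him).mul_const Complex.I)
    simpa [Complex.re_add_im] using this
  have h2 := hlim.sub_const (G u₀)
  rw [sub_self] at h2
  refine h2.congr fun k => ?_
  rw [← map_sub]
  rfl

end Spectral

/-! ### The forms and energies of matrix fields -/

section Forms

variable {n : ℕ} {s : ℝ} {Ω : Set (Sp n)} {lam Lam : ℝ} {A : Sp n → Matrix (Fin n) (Fin n) ℝ}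

theorem MClass.norm_le (hA : MClass lam Lam A) (hLam : 0 < Lam) :
    ∀ᵐ x, ∀ ξ : Sp n, ‖(A x).toEuclideanLin ξ‖ ≤ Lam * ‖ξ‖ := by
  filter_upwards [hA.upper] with x hx ξ
  have h1 := (hx ξ).trans (real_inner_le_norm _ _)
  rw [inv_mul_le_iff₀ hLam] at h1
  rcases (norm_nonneg ((A x).toEuclideanLin ξ)).eq_or_lt with h0 | h0
  · rw [← h0]; positivity
  · nlinarith

theorem aestronglyMeasurable_toEuclideanLin (hA : MClass lam Lam A) {g : Sp n → Sp n}
    (hg : AEStronglyMeasurable g volume) :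
    AEStronglyMeasurable (fun x => (A x).toEuclideanLin (g x)) volume := by
  have h1 : AEMeasurable (fun x => fun i : Fin n => ((A x).toEuclideanLin (g x)) i) volume := by
    refine aemeasurable_pi_lambda _ fun i => ?_
    have : ∀ x, ((A x).toEuclideanLin (g x)) i = ∑ j, A x i j * g x j := fun x => rfl
    simp only [this]
    refine Finset.aemeasurable_fun_sum _ fun j _ => (hA.aemeasurable i j).mul ?_
    exact (EuclideanSpace.proj (𝕜 := ℝ) j).continuous.measurable.comp_aemeasurable hg.aemeasurable
  exact ((PiLp.continuous_toLp 2 _).measurable.comp_aemeasurable h1).aestronglyMeasurable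

theorem memLp_toEuclideanLin (hA : MClass lam Lam A) (hLam : 0 < Lam) (g : L2Vec n) :
    MemLp (fun x => (A x).toEuclideanLin (g x)) 2 volume :=
  (Lp.memLp g).of_le_mul (aestronglyMeasurable_toEuclideanLin hA (Lp.memLp g).1) (c := Lam)
    ((hA.norm_le hLam).mono fun x hx => hx (g x))

/-- The bounded operator on `L²(ℝⁿ; ℝⁿ)` of multiplication by a matrix field. -/
noncomputable def mulField (hA : MClass lam Lam A) (hLam : 0 < Lam) : L2Vec n →L[ℝ] L2Vec n :=
  LinearMap.mkContinuous
    { toFun := fun g => (memLp_toEuclideanLin hA hLam g).toLp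
      map_add' := by
        intro g g'
        rw [← MemLp.toLp_add]
        refine MemLp.toLp_congr _ _ ?_
        filter_upwards [Lp.coeFn_add g g'] with x hx
        rw [hx, Pi.add_apply, map_add, Pi.add_apply]
      map_smul' := by
        intro r g
        rw [RingHom.id_apply, ← MemLp.toLp_const_smul]
        refine MemLp.toLp_congr _ _ ?_
        filter_upwards [Lp.coeFn_smul r g] with x hx
        rw [hx, Pi.smul_apply, map_smul, Pi.smul_apply] }
    Lam (by
      intro g
      refine Lp.norm_le_mul_norm_of_ae_le_mul ?_
      filter_upwards [(memLp_toEuclideanLin hA hLam g).coeFn_toLp, hA.norm_le hLam] with x h1 h2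
      exact (congrArg norm h1).trans_le (h2 _))

theorem mulField_ae (hA : MClass lam Lam A) (hLam : 0 < Lam) (g : L2Vec n) :
    mulField hA hLam g =ᵐ[volume] fun x => (A x).toEuclideanLin (g x) :=
  (memLp_toEuclideanLin hA hLam g).coeFn_toLp

/-- The gradient part of `H^s_0(O)` as a bounded operator. -/
noncomputable def Hs0.gradL (s : ℝ) (Ω : Set (Sp n)) : Hs0 s Ω →L[ℝ] L2Vec n :=
  (WithLp.sndL 2 ℝ (L2 n) (L2Vec n)).comp (Hs0 s Ω).subtypeL

/-- The bilinear form of `A` as a bounded bilinear map. -/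
noncomputable def bilinL (s : ℝ) (Ω : Set (Sp n)) (hA : MClass lam Lam A) (hLam : 0 < Lam) :
    Hs0 s Ω →L[ℝ] Hs0 s Ω →L[ℝ] ℝ :=
  (innerSL ℝ).bilinearComp ((mulField hA hLam).comp (Hs0.gradL s Ω)) (Hs0.gradL s Ω)

theorem bilinL_apply (hA : MClass lam Lam A) (hLam : 0 < Lam) (U V : Hs0 s Ω) :
    bilinL s Ω hA hLam U V = bilin A U V := by
  change inner ℝ (mulField hA hLam (Hs0.grad U)) (Hs0.grad V) = _
  rw [L2.inner_def, bilin]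
  refine integral_congr_ae ?_
  filter_upwards [mulField_ae hA hLam (Hs0.grad U)] with x hx
  rw [hx]

theorem MSym.bilin_comm (hA : MSym lam Lam A) (U V : Hs0 s Ω) : bilin A U V = bilin A V U := by
  refine integral_congr_ae ?_
  filter_upwards [hA.symm] with x hx
  have hsym : ((A x).toEuclideanLin).IsSymmetric := by
    rw [Matrix.isSymmetric_toEuclideanLin_iff, Matrix.IsHermitian,
      Matrix.conjTranspose_eq_transpose_of_trivial]
    exact hx.symm
  rw [hsym, real_inner_comm]

theorem MClass.le_bilin (hA : MClass lam Lam A) (hLam : 0 < Lam) (U : Hs0 s Ω) :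
    lam * ‖Hs0.grad U‖ ^ 2 ≤ bilin A U U := by
  rw [norm_sq_eq_integral ℝ, ← integral_const_mul]
  refine integral_mono_ae ((integrable_norm_sq _).const_mul _) ?_ ?_
  · refine (L2.integrable_inner (𝕜 := ℝ) (mulField hA hLam (Hs0.grad U)) (Hs0.grad U)).congr ?_
    filter_upwards [mulField_ae hA hLam (Hs0.grad U)] with x hx
    rw [hx]
  · filter_upwards [hA.lower] with x hx
    exact hx _

/-- Ellipticity controls only the gradient; the Poincaré inequality recovers the full norm. The
constant does not depend on `A`, giving coercivity uniform in `h`. -/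
theorem exists_coercive (hn : 0 < n) (hs : s ∈ Set.Ioo (0 : ℝ) 1) (hΩ : MeasurableSet Ω)
    (hfin : volume Ω ≠ ⊤) (hlam : 0 < lam) (hLam : 0 < Lam) :
    ∃ c > 0, ∀ (A : Sp n → Matrix (Fin n) (Fin n) ℝ), MClass lam Lam A →
      ∀ U : Hs0 s Ω, c * ‖U‖ ^ 2 ≤ bilin A U U := by
  obtain ⟨C, hC⟩ := exists_poincare (n := n) hn hs hΩ hfin
  -- The `+ 1` accounts for the gradient part of the norm; `max C 0` is used because the Poincaré
  -- constant comes without a sign.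
  refine ⟨lam / (max C 0 + 1), by positivity, fun A hA U => ?_⟩
  have h1 := hC (U : L2Pair n) (Hs0_le_spectralPairs hn hs U.2)
  have h2 := hA.le_bilin hLam U
  have h3 : ‖U‖ ^ 2 = ‖(U : L2Pair n).fst‖ ^ 2 + ‖(U : L2Pair n).snd‖ ^ 2 :=
    WithLp.prod_norm_sq_eq_of_L2 (U : L2Pair n)
  have h4 : ‖U‖ ^ 2 ≤ (max C 0 + 1) * ‖Hs0.grad U‖ ^ 2 := by
    have h5 : C * ‖(U : L2Pair n).snd‖ ^ 2 ≤ max C 0 * ‖(U : L2Pair n).snd‖ ^ 2 := by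
      gcongr; exact le_max_left _ _
    rw [h3, add_mul, one_mul]
    exact add_le_add (h1.trans h5) le_rfl
  refine le_trans ?_ h2
  rw [div_mul_eq_mul_div, div_le_iff₀ (by positivity), mul_assoc, mul_comm (‖Hs0.grad U‖ ^ 2)]
  gcongr

theorem separableSpace_Hs0 (s : ℝ) (Ω : Set (Sp n)) :
    TopologicalSpace.SeparableSpace (Hs0 s Ω) := by
  have : Fact ((2 : ℝ≥0∞) ≠ ⊤) := ⟨by norm_num⟩
  have h1 : SecondCountableTopology (L2 n) := Lp.SecondCountableTopology
  have h2 : SecondCountableTopology (L2Vec n) := Lp.SecondCountableTopology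
  have h3 : SecondCountableTopology (L2Pair n) :=
    WithLp.secondCountableTopology 2 (L2 n) (L2Vec n)
  have h4 : SecondCountableTopology (Hs0 s Ω) :=
    TopologicalSpace.Subtype.secondCountableTopology _
  infer_instance

theorem energy_eq_quadEnergy (hA : MClass lam Lam A) (hLam : 0 < Lam) :
    energy s Ω A = quadEnergy (Hs0.toL2L s Ω) (bilinL s Ω hA hLam) := by
  ext u
  simp only [energy, quadEnergy, bilinL_apply]
  rfl

end Forms

end NonlocalGConv

/-! ### The equivalence for the nonlocal problems -/

theorem mainTheorem7 (n : ℕ) (hn : 2 ≤ n) (s : ℝ) (hs : s ∈ Set.Ioo (0 : ℝ) 1)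
    (Ω : Set (EuclideanSpace ℝ (Fin n))) (hΩo : IsOpen Ω) (hΩb : Bornology.IsBounded Ω)
    (lam Lam : ℝ) (hlam : 0 < lam) (hle : lam ≤ Lam)
    (A : ℕ → EuclideanSpace ℝ (Fin n) → Matrix (Fin n) (Fin n) ℝ)
    (Ainf : EuclideanSpace ℝ (Fin n) → Matrix (Fin n) (Fin n) ℝ)
    (hA : ∀ h, NonlocalGConv.MSym lam Lam (A h)) (hAinf : NonlocalGConv.MSym lam Lam Ainf) :
    NonlocalGConv.GConverges s Ω A Ainf ↔
      NonlocalGConv.GammaConverges (fun h => NonlocalGConv.energy s Ω (A h))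
        (NonlocalGConv.energy s Ω Ainf) := by
  open NonlocalGConv in
  have hn0 : 0 < n := by omega
  have hLam : 0 < Lam := hlam.trans_le hle
  have hΩ : MeasurableSet Ω := hΩo.measurableSet
  have hfin : volume Ω ≠ ⊤ := hΩb.measure_lt_top.ne
  have : CompleteSpace (Hs0 s Ω) :=
    (Submodule.isClosed_topologicalClosure _).completeSpace_coe
  have : TopologicalSpace.SeparableSpace (Hs0 s Ω) := separableSpace_Hs0 s Ω
  obtain ⟨c, hc, hcoer⟩ := exists_coercive (Ω := Ω) hn0 hs hΩ hfin hlam hLam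
  have key := weakTendsto_iff_gammaConverges (T := Hs0.toL2L s Ω)
    (B := fun h => bilinL s Ω (hA h).toMClass hLam) (Binf := bilinL s Ω hAinf.toMClass hLam)
    (Hs0.toL2L_tendsto hn0 hs hΩ hfin) (Hs0.toL2L_injective hn0 hs) hc
    (fun h u => by rw [bilinL_apply]; exact hcoer _ (hA h).toMClass u)
    (fun h u v => by rw [bilinL_apply, bilinL_apply]; exact (hA h).bilin_comm u v)
    (fun u => by rw [bilinL_apply]; exact hcoer _ hAinf.toMClass u)
    (fun u v => by rw [bilinL_apply, bilinL_apply]; exact hAinf.bilin_comm u v)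
  simp only [bilinL_apply] at key
  simp only [energy_eq_quadEnergy (hA _).toMClass hLam, energy_eq_quadEnergy hAinf.toMClass hLam]
  exact key
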